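/- Let $\Delta(x,t)=P(x,t)/Q(x,t)$ be a rational function with $P,Q\in\mathbb C[x,t]$. Let $U\subseteq\mathbb C$ be open and let $x_l,x_r:U\to\mathbb R$ be continuous with $0\le x_l(t)<x_r(t)$ for all $t\in U$. Assume that for every $t\in U$ the polynomial $P(\cdot,t)\,Q(\cdot,t)$ is not zero and all its roots are simple, i.e. the zeros and poles of $x\mapsto\Delta(x,t)$ in $\mathbb C$ are all simple and different. Suppose that $\sqrt\Delta$ has an analytic branch on the family of annuli $$D=\{(x,t): t\in U,\ x_l(t)<|x|<x_r(t)\},$$ i.e. there is an analytic function $f=\sqrt{\Delta}$ on $D$ with $f^2=\Delta$. Suppose also that, for every $t\in U$, $\sqrt{\Delta(\cdot,t)}$ has at least one singularity in $\{x\in\mathbb C:|x|\le x_l(t)\}$ and at least one in $\{x\in\mathbb C:|x|\ge x_r(t)\}$. Here $x_0\in\mathbb C$ is a singularity of $\sqrt{\Delta(\cdot,t)}$ if there is no function $h$ analytic at $x_0$ with $h(x)^2=\Delta(x,t)$ for all $x\ne x_0$ near $x_0$. Then for every $t\in U$ there is a Laurent expansion $$\sqrt{\Delta(x,t)}=\sum_{i\in\mathbb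 Z}a_i(t)x^i,\qquad x_l(t)<|x|<x_r(t),$$ and it has infinitely many nonzero terms of positive degree and infinitely many nonzero terms of negative degree. Write $\sqrt\Delta=A+B$ on $D$ with $$A=[x^{\ge}]\sqrt\Delta=\sum_{i\ge 0}a_i(t)x^i,\qquad B=[x^{<}]\sqrt\Delta=\sum_{i<0}a_i(t)x^i .$$ The series $A$ converges to an analytic function on $\{(x,t):t\in U,\ |x|<x_r(t)\}$, and $B$ to one on $\{(x,t):t\in U,\ |x|>x_l(t)\}$. On these sets both $A$ and $B$ are D-finite over $x$ and $t$: each of them satisfies a linear differential equation $\sum_{j=0}^n c_j(x,t)\,\partial_x^jF=0$ and a linear differential equation $\sum_{j=0}^m d_j(x,t)\,\partial_t^jF=0$, where the $c_j$, and likewise the $d_j$, are polynomials in $\mathbb C[x,t]$ that are not all zero. -/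

import Mathlib

open Polynomial Topology

/-- The polynomial `P(·, t) ∈ ℂ[x]` obtained from `P ∈ ℂ[t][x]` (outer variable `x`, inner
variable `t`) by giving the parameter `t` a complex value. -/
noncomputable def specializeAt (P : Polynomial (Polynomial ℂ)) (t : ℂ) : Polynomial ℂ :=
  P.map (evalRingHom t)

/-- The value at `(x, t)` of the rational function `P / Q ∈ ℂ(x, t)`. -/
noncomputable def ratEval (P Q : Polynomial (Polynomial ℂ)) (x t : ℂ) : ℂ :=
  (specializeAt P t).eval x / (specializeAt Q t).eval x

/-- For this value of `t`, `P(·, t) / Q(·, t)` is a nonzero rational function of `x`, written in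
lowest terms, all of whose zeros and poles in `ℂ` are different (the roots of `P(·, t) Q(·, t)`,
listed with multiplicity, are pairwise distinct). -/
def HasDistinctZerosAndPoles (P Q : Polynomial (Polynomial ℂ)) (t : ℂ) : Prop :=
  specializeAt P t * specializeAt Q t ≠ 0 ∧
    (specializeAt P t * specializeAt Q t).roots.Nodup

/-- `x₀` is a singularity of `√g`: no branch of `√g` is (or extends to be) analytic at `x₀`. -/
def IsSingularityOfSqrt (g : ℂ → ℂ) (x₀ : ℂ) : Prop :=
  ¬ ∃ h : ℂ → ℂ, AnalyticAt ℂ h x₀ ∧ ∀ᶠ x in 𝓝[≠] x₀, h x ^ 2 = g x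

/-- The family of annuli `{(x, t) : t ∈ U, r t < |x| < R t}`. -/
def annulusFamily (U : Set ℂ) (r R : ℂ → ℝ) : Set (ℂ × ℂ) :=
  {p | p.2 ∈ U ∧ r p.2 < ‖p.1‖ ∧ ‖p.1‖ < R p.2}

/-- The family of discs `{(x, t) : t ∈ U, |x| < R t}`. -/
def discFamily (U : Set ℂ) (R : ℂ → ℝ) : Set (ℂ × ℂ) :=
  {p | p.2 ∈ U ∧ ‖p.1‖ < R p.2}

/-- The family of disc exteriors `{(x, t) : t ∈ U, r t < |x|}`. -/
def exteriorFamily (U : Set ℂ) (r : ℂ → ℝ) : Set (ℂ × ℂ) :=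
  {p | p.2 ∈ U ∧ r p.2 < ‖p.1‖}

/-- The Laurent series `∑ i ∈ ℤ, c i * x ^ i` converges (absolutely) at `x`, with sum `s`. -/
def HasLaurentSum (c : ℤ → ℂ) (x s : ℂ) : Prop :=
  HasSum (fun i : ℤ => c i * x ^ i) s

/-- Coefficients of `[x^≥]`, the terms of nonnegative degree. -/
def laurentNonnegPart (c : ℤ → ℂ) : ℤ → ℂ := fun i => if 0 ≤ i then c i else 0

/-- Coefficients of `[x^<]`, the terms of negative degree. -/
def laurentNegPart (c : ℤ → ℂ) : ℤ → ℂ := fun i => if i < 0 then c i else 0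

/-- On `W`, `F(x, t)` satisfies a nontrivial linear differential equation
`∑ j ≤ n, c_j(x, t) ∂^j F / ∂x^j = 0` with coefficients in `ℂ[x, t]` (equivalently, after clearing
denominators, in `ℂ(x, t)`). -/
def IsDFiniteInX (F : ℂ × ℂ → ℂ) (W : Set (ℂ × ℂ)) : Prop :=
  ∃ (n : ℕ) (c : Fin (n + 1) → Polynomial (Polynomial ℂ)), c ≠ 0 ∧
    ∀ x t : ℂ, (x, t) ∈ W →
      ∑ j : Fin (n + 1),
        (specializeAt (c j) t).eval x * iteratedDeriv (j : ℕ) (fun y => F (y, t)) x = 0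

/-- The same with the derivatives `∂^j F / ∂t^j`. -/
def IsDFiniteInT (F : ℂ × ℂ → ℂ) (W : Set (ℂ × ℂ)) : Prop :=
  ∃ (n : ℕ) (c : Fin (n + 1) → Polynomial (Polynomial ℂ)), c ≠ 0 ∧
    ∀ x t : ℂ, (x, t) ∈ W →
      ∑ j : Fin (n + 1),
        (specializeAt (c j) t).eval x * iteratedDeriv (j : ℕ) (fun s => F (x, s)) t = 0

/-- `F` is analytic on `W` and D-finite over `x` and `t` there. -/
def IsDFiniteOn (F : ℂ × ℂ → ℂ) (W : Set (ℂ × ℂ)) : Prop :=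
  AnalyticOnNhd ℂ F W ∧ IsDFiniteInX F W ∧ IsDFiniteInT F W

/-! For a radius `ρ` strictly between `r t` and `R t`, both Laurent parts are Cauchy transforms: `A`
is `(2πi)⁻¹ ∮ f(y,t)/(y-x) dy` over `|y| = ρ` when `|x| < ρ`, and `B` is minus that integral when
`|x| > ρ`. One circle serves for all nearby `t`, so analyticity of `A` and `B` is that of an
integral with analytic parameters (`analyticAt_cauchyTransform`).

D-finiteness is creative telescoping. Simplicity of the zeros and poles forces `P Q ≠ 0` on the
annuli, so `E = 2PQ(y-x)` does not vanish on the circle and `E f' = M f` for a polynomial `M`, the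
prime being `d/dy`. The `l`-th derivative of the integrand in `x`, or in `t`, is `H_l = f N_l /
E^(l+1)` with `deg_y N_l` growing linearly in `l`, and `y`-derivatives keep this shape. Hence the
`∂_y^k H_l` with `l, k ≤ n` are `f / E^(2n+1)` times `(n+1)²` polynomials in `y` of degree `O(n)`,
which are dependent over `ℂ[x,t]` once `n` is large. Let `k₀` be the lowest order of `∂_y` in the
relation. Integrating it against `y^k₀` and by parts removes all other orders and leaves a
nontrivial relation between the `∮ H_l` (`exists_telescoper`). Its coefficients do not depend on
`ρ`, so one equation holds on the whole domain.

If only finitely many positive degrees occurred, `f` would continue analytically to `|x| > r t`,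
leaving no outer singularity. If only finitely many negative degrees occurred, `f` would continue to
the disc with at most a pole at `0`: without a pole there is no inner singularity, and with one `Δ`
would have a pole of even order, against simplicity. -/

open Metric Set Filter Complex

/-! ### Cauchy transforms with parameters: analyticity and derivatives under the integral sign. -/

section CauchyTransform

/-- The circle integral as a continuous functional on the continuous functions on the circle. -/
theorem exists_clm_eq_circleIntegral {ρ : ℝ} (hρ : 0 < ρ) :
    ∃ Λ : C(sphere (0 : ℂ) ρ, ℂ) →L[ℂ] ℂ, ∀ (φ : C(sphere (0 : ℂ) ρ, ℂ)) (g : ℂ → ℂ),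
      (∀ y, φ y = g y) → Λ φ = ∮ z in C(0, ρ), g z := by
  have hm : ∀ θ : ℝ, circleMap 0 ρ θ ∈ sphere (0 : ℂ) ρ := fun θ =>
    circleMap_mem_sphere 0 hρ.le θ
  have hcm : Continuous fun θ : ℝ => (⟨circleMap 0 ρ θ, hm θ⟩ : sphere (0 : ℂ) ρ) :=
    (continuous_circleMap 0 ρ).subtype_mk hm
  have hcd : Continuous (deriv (circleMap 0 ρ)) := by
    have : deriv (circleMap 0 ρ) = fun θ => circleMap 0 ρ θ * I := by
      ext θ; simp
    rw [this]
    exact (continuous_circleMap 0 ρ).mul continuous_const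
  have hc : ∀ φ : C(sphere (0 : ℂ) ρ, ℂ), Continuous fun θ : ℝ =>
      deriv (circleMap 0 ρ) θ • φ ⟨circleMap 0 ρ θ, hm θ⟩ := fun φ =>
    hcd.smul (φ.continuous.comp hcm)
  let Λ₀ : C(sphere (0 : ℂ) ρ, ℂ) →ₗ[ℂ] ℂ :=
    { toFun := fun φ => ∫ θ in (0 : ℝ)..2 * Real.pi,
        deriv (circleMap 0 ρ) θ • φ ⟨circleMap 0 ρ θ, hm θ⟩
      map_add' := fun φ ψ => by
        rw [← intervalIntegral.integral_add ((hc φ).intervalIntegrable _ _)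
          ((hc ψ).intervalIntegrable _ _)]
        simp only [ContinuousMap.add_apply, smul_add]
      map_smul' := fun a φ => by
        rw [RingHom.id_apply, ← intervalIntegral.integral_smul]
        simp only [ContinuousMap.smul_apply, smul_comm a] }
  refine ⟨Λ₀.mkContinuous (ρ * |2 * Real.pi - 0|) fun φ => ?_, fun φ g h => ?_⟩
  · have : ∀ θ ∈ Set.uIoc (0 : ℝ) (2 * Real.pi),
        ‖deriv (circleMap 0 ρ) θ • φ ⟨circleMap 0 ρ θ, hm θ⟩‖ ≤ ρ * ‖φ‖ := fun θ _ => by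
      rw [norm_smul]
      have h1 : ‖deriv (circleMap 0 ρ) θ‖ = ρ := by simp [abs_of_pos hρ]
      rw [h1]
      exact mul_le_mul_of_nonneg_left (φ.norm_coe_le_norm _) hρ.le
    calc _ ≤ ρ * ‖φ‖ * |2 * Real.pi - 0| := intervalIntegral.norm_integral_le_of_norm_le_const this
      _ = _ := by ring
  · simp only [LinearMap.mkContinuous_apply, circleIntegral]
    exact intervalIntegral.integral_congr fun θ _ => by
      simp only [h]

variable {E F : Type*} [NormedAddCommGroup E] [NormedSpace ℂ E] [NormedAddCommGroup F]
  [NormedSpace ℂ F]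

theorem iteratedDeriv_clm_apply [CompleteSpace E] (Λ : E →L[ℂ] F) {h : ℂ → E} {t : ℂ}
    (hh : AnalyticAt ℂ h t) (l : ℕ) :
    iteratedDeriv l (fun s => Λ (h s)) t = Λ (iteratedDeriv l h t) := by
  have := Λ.iteratedFDeriv_comp_left (hh.contDiffAt (n := l)) (i := l) le_rfl
  rw [iteratedDeriv_eq_iteratedFDeriv, iteratedDeriv_eq_iteratedFDeriv]
  exact congrArg (fun m => m fun _ => 1) this

/-- A jointly analytic function is an analytic curve of continuous functions on compact slices. -/
theorem exists_analyticAt_curry {W : Set (ℂ × ℂ)} (hW : IsOpen W) {f : ℂ × ℂ → ℂ}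
    (hf : AnalyticOnNhd ℂ f W) {K : Set ℂ} [CompactSpace K] {t₀ : ℂ}
    (hKW : ∀ y ∈ K, (y, t₀) ∈ W) :
    ∃ h : ℂ → C(K, ℂ), AnalyticAt ℂ h t₀ ∧ ∀ᶠ t in 𝓝 t₀, ∀ y : K, h t y = f (y, t) := by
  have hK : IsCompact K := isCompact_iff_compactSpace.mpr inferInstance
  obtain ⟨u, v, -, hv, hKu, htv, huv⟩ := generalized_tube_lemma hK (isCompact_singleton (x := t₀)) hW
    (by rintro ⟨y, t⟩ ⟨hy, ht⟩; obtain rfl : t = t₀ := ht; exact hKW y hy)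
  obtain ⟨δ, hδ, hδv⟩ := Metric.nhds_basis_closedBall.mem_iff.mp
    (hv.mem_nhds (htv (mem_singleton t₀)))
  have hmem : ∀ y ∈ K, ∀ t ∈ closedBall t₀ δ, (y, t) ∈ W := fun y hy t ht =>
    huv ⟨hKu hy, hδv ht⟩
  classical
  let g : ℂ → C(K, ℂ) := fun s =>
    if h : Continuous (fun y : K => f (y, s)) then ⟨_, h⟩ else 0
  have hg : ∀ s ∈ closedBall t₀ δ, ∀ y : K, g s y = f (y, s) := fun s hs y => by
    have : Continuous (fun y : K => f (y, s)) := continuous_iff_continuousAt.mpr fun y =>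
      ((hf _ (hmem y y.2 s hs)).continuousAt).comp
        (f := fun y : K => ((y : ℂ), s)) (by fun_prop)
    simp [g, this]
  have hgc : ContinuousOn g (closedBall t₀ δ) := by
    refine ContinuousMap.continuousOn_of_continuousOn_uncurry _ ?_
    have : ContinuousOn (fun p : ℂ × K => f (p.2, p.1)) (closedBall t₀ δ ×ˢ univ) := fun p hp =>
      (((hf _ (hmem p.2 p.2.2 p.1 hp.1)).continuousAt).comp
        (f := fun p : ℂ × K => ((p.2 : ℂ), p.1)) (by fun_prop)).continuousWithinAt
    exact this.congr fun p hp => hg p.1 hp.1 p.2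
  have hci : CircleIntegrable g t₀ δ :=
    (hgc.mono sphere_subset_closedBall).circleIntegrable hδ.le
  let δ' : NNReal := ⟨δ, hδ.le⟩
  -- The curve is the `C(K, ℂ)`-valued Cauchy integral of `g`, analytic because `g` is continuous.
  -- Evaluation at `y` commutes with the integral, so the scalar Cauchy formula identifies its
  -- values with those of `f`.
  refine ⟨_, (hasFPowerSeriesOn_cauchy_integral (R := δ') hci hδ).analyticAt, ?_⟩
  filter_upwards [Metric.ball_mem_nhds t₀ hδ] with t ht y
  have hd : DifferentiableOn ℂ (fun s => f (y, s)) (closedBall t₀ δ) := fun s hs =>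
    (((hf _ (hmem y y.2 s hs)).differentiableAt).comp s
      (f := fun s : ℂ => ((y : ℂ), s)) (by fun_prop)).differentiableWithinAt
  have hcauchy := hd.circleIntegral_sub_inv_smul ht
  have hcont : ContinuousOn (fun z => (z - t)⁻¹ • g z) (sphere t₀ δ) := by
    refine ContinuousOn.smul (ContinuousOn.inv₀ (continuousOn_id.sub continuousOn_const) fun z hz => ?_)
      (hgc.mono sphere_subset_closedBall)
    refine sub_ne_zero.mpr fun h => ?_
    obtain rfl : z = t := h
    exact (mem_ball.mp ht).ne (mem_sphere.mp hz)
  have hev : (ContinuousMap.evalCLM ℂ y) (∮ z in C(t₀, δ), (z - t)⁻¹ • g z)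
      = ∮ z in C(t₀, δ), (z - t)⁻¹ • f (y, z) := by
    rw [circleIntegral, circleIntegral, ← ContinuousLinearMap.intervalIntegral_comp_comm _
      (hcont.circleIntegrable hδ.le).out]
    refine intervalIntegral.integral_congr fun θ _ => ?_
    simp only [map_smul]
    congr 2
    exact hg _ (sphere_subset_closedBall (circleMap_mem_sphere t₀ hδ.le θ)) y
  have hpi : (2 * Real.pi * I : ℂ) ≠ 0 := Complex.two_pi_I_ne_zero
  change (ContinuousMap.evalCLM ℂ y) ((2 * Real.pi * I : ℂ)⁻¹ •
    ∮ z in C(t₀, δ), (z - t)⁻¹ • g z) = _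
  rw [map_smul, hev, hcauchy, inv_smul_smul₀ hpi]

/-- The Cauchy kernel is an analytic curve of continuous functions on compact sets. -/
theorem exists_analyticAt_cauchyKernel {K : Set ℂ} [CompactSpace K] {x₀ : ℂ} (hx : x₀ ∉ K) :
    ∃ k : ℂ → C(K, ℂ), AnalyticAt ℂ k x₀ ∧
      ∀ᶠ x in 𝓝 x₀, ∀ y : K, k x y = ((y : ℂ) - x)⁻¹ := by
  have hW : IsOpen {p : ℂ × ℂ | p.1 ≠ p.2} := isOpen_ne_fun continuous_fst continuous_snd
  refine exists_analyticAt_curry (f := fun p => (p.1 - p.2)⁻¹) hW (fun p hp => ?_)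
    fun y hy => ?_
  · exact (analyticAt_fst.sub analyticAt_snd).inv (sub_ne_zero.mpr hp)
  · exact fun h => hx (by obtain rfl : y = x₀ := h; exact hy)

theorem iteratedDeriv_inv_sub (l : ℕ) (y x : ℂ) :
    iteratedDeriv l (fun x => (y - x)⁻¹) x = l.factorial * ((y - x) ^ (l + 1))⁻¹ := by
  have := congrFun (iter_deriv_inv_linear l (-1 : ℂ) y) x
  rw [iteratedDeriv_eq_iterate]
  have h2 : (fun x => (y - x)⁻¹) = fun x : ℂ => (-1 * x + y)⁻¹ := by ext x; ring_nf
  rw [h2, this]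
  have : (-1 * x + y) ^ (-1 - (l : ℤ)) = ((y - x) ^ (l + 1))⁻¹ := by
    rw [show (-1 - (l : ℤ)) = -((l + 1 : ℕ) : ℤ) by push_cast; ring, zpow_neg, zpow_natCast]
    ring_nf
  rw [this]
  have : ((-1 : ℂ) ^ l * (-1) ^ l) = 1 := by rw [← mul_pow]; simp
  linear_combination (l.factorial * ((y - x) ^ (l + 1))⁻¹ : ℂ) * this

/-- The Cauchy transform in the first variable over the circle of radius `ρ`. -/
noncomputable def cauchyTransform (f : ℂ × ℂ → ℂ) (ρ : ℝ) (p : ℂ × ℂ) : ℂ :=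
  (2 * Real.pi * I : ℂ)⁻¹ * ∮ y in C(0, ρ), (y - p.1)⁻¹ * f (y, p.2)

variable {W : Set (ℂ × ℂ)} {f : ℂ × ℂ → ℂ} {ρ : ℝ} {x₀ t₀ : ℂ}

/-- Up to the factor `2πi`, the transform near `(x₀, t₀)` is `Λ (k x * h t)`: a bounded functional
on the Banach algebra of continuous functions on the circle, applied to a product of two analytic
curves. Differentiation under the integral becomes commutation with `Λ`. -/
theorem exists_cauchyTransform_factorization (hW : IsOpen W) (hf : AnalyticOnNhd ℂ f W)
    (hρ : 0 < ρ) (hx : ‖x₀‖ ≠ ρ) (hρW : ∀ y ∈ sphere (0 : ℂ) ρ, (y, t₀) ∈ W) :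
    ∃ (Λ : C(sphere (0 : ℂ) ρ, ℂ) →L[ℂ] ℂ) (k h : ℂ → C(sphere (0 : ℂ) ρ, ℂ)),
      (∀ (φ : C(sphere (0 : ℂ) ρ, ℂ)) (g : ℂ → ℂ),
        (∀ y, φ y = g y) → Λ φ = ∮ z in C(0, ρ), g z) ∧
      AnalyticAt ℂ k x₀ ∧ AnalyticAt ℂ h t₀ ∧
      (∀ᶠ x in 𝓝 x₀, ∀ y : sphere (0 : ℂ) ρ, k x y = ((y : ℂ) - x)⁻¹) ∧
      (∀ᶠ t in 𝓝 t₀, ∀ y : sphere (0 : ℂ) ρ, h t y = f (y, t)) := by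
  obtain ⟨Λ, hΛ⟩ := exists_clm_eq_circleIntegral hρ
  obtain ⟨k, hk, hk'⟩ := exists_analyticAt_cauchyKernel (K := sphere (0 : ℂ) ρ) (x₀ := x₀)
    (by simpa using hx)
  obtain ⟨h, hh, hh'⟩ := exists_analyticAt_curry hW hf hρW
  exact ⟨Λ, k, h, hΛ, hk, hh, hk', hh'⟩

theorem analyticAt_cauchyTransform (hW : IsOpen W) (hf : AnalyticOnNhd ℂ f W)
    (hρ : 0 < ρ) (hx : ‖x₀‖ ≠ ρ) (hρW : ∀ y ∈ sphere (0 : ℂ) ρ, (y, t₀) ∈ W) :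
    AnalyticAt ℂ (cauchyTransform f ρ) (x₀, t₀) := by
  obtain ⟨Λ, k, h, hΛ, hk, hh, hk', hh'⟩ :=
    exists_cauchyTransform_factorization hW hf hρ hx hρW
  have hk2 : AnalyticAt ℂ (fun p : ℂ × ℂ => k p.1) (x₀, t₀) :=
    AnalyticAt.comp (f := fun p : ℂ × ℂ => p.1) hk analyticAt_fst
  have hh2 : AnalyticAt ℂ (fun p : ℂ × ℂ => h p.2) (x₀, t₀) :=
    AnalyticAt.comp (f := fun p : ℂ × ℂ => p.2) hh analyticAt_snd
  have hΛ2 : AnalyticAt ℂ (fun p : ℂ × ℂ => (2 * Real.pi * I : ℂ)⁻¹ * Λ (k p.1 * h p.2))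
      (x₀, t₀) :=
    analyticAt_const.mul ((Λ.analyticAt _).comp (f := fun p : ℂ × ℂ => k p.1 * h p.2)
      (hk2.mul hh2))
  refine hΛ2.congr ?_
  rw [nhds_prod_eq]
  filter_upwards [hk'.prod_mk hh'] with p hp
  rw [cauchyTransform, hΛ _ (fun y => (y - p.1)⁻¹ * f (y, p.2)) fun y => ?_]
  simp [hp.1, hp.2]

theorem iteratedDeriv_cauchyTransform_snd (hW : IsOpen W) (hf : AnalyticOnNhd ℂ f W)
    (hρ : 0 < ρ) (hx : ‖x₀‖ ≠ ρ) (hρW : ∀ y ∈ sphere (0 : ℂ) ρ, (y, t₀) ∈ W) (l : ℕ) :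
    iteratedDeriv l (fun t => cauchyTransform f ρ (x₀, t)) t₀ =
      (2 * Real.pi * I : ℂ)⁻¹ *
        ∮ y in C(0, ρ), (y - x₀)⁻¹ * iteratedDeriv l (fun t => f (y, t)) t₀ := by
  obtain ⟨Λ, k, h, hΛ, hk, hh, hk', hh'⟩ :=
    exists_cauchyTransform_factorization hW hf hρ hx hρW
  have hk0 := hk'.self_of_nhds
  let Λ' : C(sphere (0 : ℂ) ρ, ℂ) →L[ℂ] ℂ :=
    (2 * Real.pi * I : ℂ)⁻¹ • Λ.comp (ContinuousLinearMap.mul ℂ _ (k x₀))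
  have heq : (fun t => cauchyTransform f ρ (x₀, t)) =ᶠ[𝓝 t₀] fun t => Λ' (h t) := by
    filter_upwards [hh'] with t ht
    have : Λ' (h t) = (2 * Real.pi * I : ℂ)⁻¹ * Λ (k x₀ * h t) := rfl
    rw [this, cauchyTransform, hΛ _ (fun y => (y - x₀)⁻¹ * f (y, t)) fun y => ?_]
    simp [hk0, ht]
  rw [heq.iteratedDeriv_eq, iteratedDeriv_clm_apply Λ' hh]
  have : Λ' (iteratedDeriv l h t₀) =
      (2 * Real.pi * I : ℂ)⁻¹ * Λ (k x₀ * iteratedDeriv l h t₀) := rfl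
  rw [this, hΛ _ (fun y => (y - x₀)⁻¹ * iteratedDeriv l (fun t => f (y, t)) t₀) fun y => ?_]
  rw [ContinuousMap.mul_apply, hk0]
  congr 1
  have h1 := iteratedDeriv_clm_apply (ContinuousMap.evalCLM ℂ y) hh l
  refine h1.symm.trans (Filter.EventuallyEq.iteratedDeriv_eq l ?_)
  filter_upwards [hh'] with t ht using ht y

theorem iteratedDeriv_cauchyTransform_fst (hW : IsOpen W) (hf : AnalyticOnNhd ℂ f W)
    (hρ : 0 < ρ) (hx : ‖x₀‖ ≠ ρ) (hρW : ∀ y ∈ sphere (0 : ℂ) ρ, (y, t₀) ∈ W) (l : ℕ) :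
    iteratedDeriv l (fun x => cauchyTransform f ρ (x, t₀)) x₀ =
      (2 * Real.pi * I : ℂ)⁻¹ *
        ∮ y in C(0, ρ), (l.factorial * ((y - x₀) ^ (l + 1))⁻¹) * f (y, t₀) := by
  obtain ⟨Λ, k, h, hΛ, hk, hh, hk', hh'⟩ :=
    exists_cauchyTransform_factorization hW hf hρ hx hρW
  have hh0 := hh'.self_of_nhds
  let Λ' : C(sphere (0 : ℂ) ρ, ℂ) →L[ℂ] ℂ :=
    (2 * Real.pi * I : ℂ)⁻¹ • Λ.comp (ContinuousLinearMap.mul ℂ _ (h t₀))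
  have heq : (fun x => cauchyTransform f ρ (x, t₀)) =ᶠ[𝓝 x₀] fun x => Λ' (k x) := by
    filter_upwards [hk'] with x hx
    have : Λ' (k x) = (2 * Real.pi * I : ℂ)⁻¹ * Λ (h t₀ * k x) := rfl
    rw [this, cauchyTransform, hΛ _ (fun y => (y - x)⁻¹ * f (y, t₀)) fun y => ?_]
    simp [hh0, hx, mul_comm]
  rw [heq.iteratedDeriv_eq, iteratedDeriv_clm_apply Λ' hk]
  have : Λ' (iteratedDeriv l k x₀) =
      (2 * Real.pi * I : ℂ)⁻¹ * Λ (h t₀ * iteratedDeriv l k x₀) := rfl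
  rw [this, hΛ _ (fun y => (l.factorial * ((y - x₀) ^ (l + 1))⁻¹) * f (y, t₀)) fun y => ?_]
  rw [ContinuousMap.mul_apply, hh0, mul_comm, ← iteratedDeriv_inv_sub]
  congr 1
  have h1 := iteratedDeriv_clm_apply (ContinuousMap.evalCLM ℂ y) hk l
  refine h1.symm.trans (Filter.EventuallyEq.iteratedDeriv_eq l ?_)
  filter_upwards [hk'] with x hx using hx y

end CauchyTransform

/-! ### Laurent expansion on an annulus. -/

section Laurent

/-- The Laurent coefficient of degree `i`, as an integral over the circle of radius `ρ`. -/
noncomputable def laurentCoeff (g : ℂ → ℂ) (ρ : ℝ) (i : ℤ) : ℂ :=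
  (2 * Real.pi * I : ℂ)⁻¹ * ∮ y in C(0, ρ), y ^ (-i - 1) * g y

/-- The annulus `{x : r < |x| < R}`. -/
def centeredAnnulus (r R : ℝ) : Set ℂ := {y | r < ‖y‖ ∧ ‖y‖ < R}

theorem isOpen_centeredAnnulus (r R : ℝ) : IsOpen (centeredAnnulus r R) :=
  (isOpen_lt continuous_const continuous_norm).inter (isOpen_lt continuous_norm continuous_const)

variable {r R ρ ρ₁ ρ₂ : ℝ} {g : ℂ → ℂ} {x : ℂ}

theorem sphere_subset_centeredAnnulus (h : r < ρ) (h' : ρ < R) :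
    sphere (0 : ℂ) ρ ⊆ centeredAnnulus r R := fun y hy => by
  have : ‖y‖ = ρ := by simpa using hy
  exact ⟨this ▸ h, this ▸ h'⟩

theorem circleIntegral_eq_of_differentiableOn_annulus (hr : 0 ≤ r)
    (hg : DifferentiableOn ℂ g (centeredAnnulus r R))
    (h₁ : ρ₁ ∈ Ioo r R) (h₂ : ρ₂ ∈ Ioo r R) :
    ∮ y in C(0, ρ₁), g y = ∮ y in C(0, ρ₂), g y := by
  wlog h : ρ₁ ≤ ρ₂ generalizing ρ₁ ρ₂
  · exact (this h₂ h₁ (le_of_not_ge h)).symm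
  have hsub : closedBall (0 : ℂ) ρ₂ \ ball 0 ρ₁ ⊆ centeredAnnulus r R := fun y hy => by
    have h1 : ‖y‖ ≤ ρ₂ := by simpa using hy.1
    have h2 : ρ₁ ≤ ‖y‖ := by simpa using hy.2
    exact ⟨h₁.1.trans_le h2, h1.trans_lt h₂.2⟩
  refine (circleIntegral_eq_of_differentiable_on_annulus_off_countable (hr.trans_lt h₁.1) h
    countable_empty (hg.continuousOn.mono hsub) fun z hz => ?_).symm
  refine hg.differentiableAt ((isOpen_centeredAnnulus r R).mem_nhds (hsub ⟨?_, ?_⟩))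
  · exact ball_subset_closedBall hz.1.1
  · exact fun hb => hz.1.2 (ball_subset_closedBall hb)

theorem laurentCoeff_eq (hr : 0 ≤ r) (hg : DifferentiableOn ℂ g (centeredAnnulus r R))
    (h₁ : ρ₁ ∈ Ioo r R) (h₂ : ρ₂ ∈ Ioo r R) (i : ℤ) :
    laurentCoeff g ρ₁ i = laurentCoeff g ρ₂ i := by
  rw [laurentCoeff, laurentCoeff, circleIntegral_eq_of_differentiableOn_annulus hr _ h₁ h₂]
  refine DifferentiableOn.mul (fun y hy => ?_) hg
  exact (differentiableAt_zpow.mpr (Or.inl (norm_pos_iff.mp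
    (hr.trans_lt hy.1)))).differentiableWithinAt

theorem hasSum_laurentCoeff_nonneg (hg : CircleIntegrable g 0 ρ) (hx : ‖x‖ < ρ) :
    HasSum (fun n : ℕ => laurentCoeff g ρ n * x ^ (n : ℤ))
      ((2 * Real.pi * I : ℂ)⁻¹ * ∮ y in C(0, ρ), (y - x)⁻¹ * g y) := by
  have hρ : 0 < ρ := (norm_nonneg x).trans_lt hx
  have h := hasSum_cauchyPowerSeries_integral hg hx
  simp only [cauchyPowerSeries_apply, zero_add, sub_zero, smul_eq_mul] at h
  refine h.congr_fun fun n => ?_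
  rw [laurentCoeff, mul_assoc, mul_comm _ (x ^ (n : ℤ)), ← circleIntegral.integral_const_mul]
  congr 1
  refine circleIntegral.integral_congr hρ.le fun y hy => ?_
  have hy0 : y ≠ 0 := by
    rintro rfl
    simp [hρ.ne] at hy
  have : y ^ (-(n : ℤ) - 1) = (y ^ n)⁻¹ * y⁻¹ := by
    rw [zpow_sub_one₀ hy0, zpow_neg, zpow_natCast]
  simp only [this, zpow_natCast, div_pow]
  field_simp

/-- On the circle `|y / x| < 1`, so `(x - y)⁻¹` is a geometric series in `y / x`, integrated
termwise by dominated convergence. The minus sign turns `(x - y)⁻¹` into the Cauchy kernel. -/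
theorem hasSum_laurentCoeff_neg (hρ : 0 < ρ) (hg : CircleIntegrable g 0 ρ) (hx : ρ < ‖x‖) :
    HasSum (fun n : ℕ => laurentCoeff g ρ (-(n + 1)) * x ^ (-((n : ℤ) + 1)))
      (-((2 * Real.pi * I : ℂ)⁻¹ * ∮ y in C(0, ρ), (y - x)⁻¹ * g y)) := by
  have hx0 : x ≠ 0 := norm_pos_iff.mp (hρ.trans hx)
  have hwR : ρ / ‖x‖ ∈ Ico (0 : ℝ) 1 :=
    ⟨div_nonneg hρ.le (norm_nonneg x), (div_lt_one (hρ.trans hx)).2 hx⟩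
  have key : HasSum (fun n : ℕ => ∮ y in C(0, ρ), (y / x) ^ n • (x⁻¹ • g y))
      (∮ y in C(0, ρ), (x - y)⁻¹ • g y) := by
    refine intervalIntegral.hasSum_integral_of_dominated_convergence
      (fun n θ => ρ * ‖x‖⁻¹ * ‖g (circleMap 0 ρ θ)‖ * (ρ / ‖x‖) ^ n)
      (fun n => ?_) (fun n => ?_) ?_ ?_ ?_
    · simp only [deriv_circleMap]
      have h₁ : MeasureTheory.AEStronglyMeasurable (fun θ : ℝ => circleMap 0 ρ θ * I)
          (MeasureTheory.volume.restrict (uIoc 0 (2 * Real.pi))) :=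
        Measurable.aestronglyMeasurable (by fun_prop)
      have h₂ : MeasureTheory.AEStronglyMeasurable (fun θ : ℝ => (circleMap 0 ρ θ / x) ^ n)
          (MeasureTheory.volume.restrict (uIoc 0 (2 * Real.pi))) :=
        Measurable.aestronglyMeasurable (by fun_prop)
      exact h₁.smul (h₂.smul (hg.def'.1.const_smul x⁻¹))
    · refine Eventually.of_forall fun θ _ => le_of_eq ?_
      simp [abs_of_pos hρ]
      ring
    · exact Eventually.of_forall fun _ _ =>
        (summable_geometric_of_lt_one hwR.1 hwR.2).mul_left _
    · simp only [tsum_mul_left, tsum_geometric_of_lt_one hwR.1 hwR.2]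
      exact (hg.norm.const_mul _).mul_const _
    · refine Eventually.of_forall fun θ _ => HasSum.const_smul _ ?_
      simp only [smul_smul]
      refine HasSum.smul_const ?_ _
      have : ‖circleMap 0 ρ θ / x‖ < 1 := by simpa [abs_of_pos hρ] using hwR.2
      convert! (hasSum_geometric_of_norm_lt_one this).mul_right x⁻¹ using 1
      rw [← mul_inv]
      congr 1
      field_simp
  have hneg : ∮ y in C(0, ρ), (x - y)⁻¹ • g y = -∮ y in C(0, ρ), (y - x)⁻¹ * g y := by
    rw [← neg_one_mul, ← circleIntegral.integral_const_mul]
    congr 1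
    ext y
    rw [← neg_sub y x, inv_neg, smul_eq_mul]
    ring
  have h := key.mul_left (2 * Real.pi * I : ℂ)⁻¹
  rw [hneg, mul_neg] at h
  refine h.congr_fun fun n => ?_
  rw [laurentCoeff, mul_assoc, mul_comm _ (x ^ _), ← circleIntegral.integral_const_mul]
  congr 2
  ext y
  rw [zpow_neg, show -(-((n : ℤ) + 1)) - 1 = (n : ℤ) by ring, zpow_natCast,
    show (n : ℤ) + 1 = ((n + 1 : ℕ) : ℤ) by push_cast; rfl, zpow_natCast, div_pow, pow_succ]
  simp only [smul_eq_mul]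
  field_simp

theorem hasSum_laurentNonnegPart {c : ℤ → ℂ} {s : ℂ}
    (h : HasSum (fun n : ℕ => c n * x ^ (n : ℤ)) s) : HasLaurentSum (laurentNonnegPart c) x s := by
  have := HasSum.of_nat_of_neg_add_one (f := fun i : ℤ => laurentNonnegPart c i * x ^ i)
    (m := s) (m' := 0) (by simpa [laurentNonnegPart] using h) (by
      convert hasSum_zero using 2 with n
      have : ¬ (0 : ℤ) ≤ -((n : ℤ) + 1) := by omega
      simp only [laurentNonnegPart, if_neg this, zero_mul])
  simpa [HasLaurentSum] using this

theorem hasSum_laurentNegPart {c : ℤ → ℂ} {s : ℂ}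
    (h : HasSum (fun n : ℕ => c (-(n + 1)) * x ^ (-((n : ℤ) + 1))) s) :
    HasLaurentSum (laurentNegPart c) x s := by
  have := HasSum.of_nat_of_neg_add_one (f := fun i : ℤ => laurentNegPart c i * x ^ i)
    (m := 0) (m' := s) (by
      convert hasSum_zero using 2 with n
      simp [laurentNegPart]) (by
      refine h.congr_fun fun n => ?_
      have : -((n : ℤ) + 1) < 0 := by omega
      simp only [laurentNegPart, if_pos this])
  simpa [HasLaurentSum] using this

theorem HasLaurentSum.of_parts {c : ℤ → ℂ} {s s' : ℂ}
    (h : HasLaurentSum (laurentNonnegPart c) x s) (h' : HasLaurentSum (laurentNegPart c) x s') :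
    HasLaurentSum c x (s + s') := by
  refine (HasSum.add h h').congr_fun fun i => ?_
  rcases le_or_gt 0 i with hi | hi
  · simp [laurentNonnegPart, laurentNegPart, hi, not_lt.mpr hi]
  · simp [laurentNonnegPart, laurentNegPart, hi, not_le.mpr hi]

/-- **Cauchy's integral formula** for an annulus. -/
theorem circleIntegral_sub_circleIntegral_eq (hr : 0 ≤ r)
    (hg : DifferentiableOn ℂ g (centeredAnnulus r R))
    (h₁ : r < ρ₁) (h₂ : ρ₁ < ‖x‖) (h₃ : ‖x‖ < ρ₂) (h₄ : ρ₂ < R) :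
    g x = (2 * Real.pi * I : ℂ)⁻¹ * (∮ y in C(0, ρ₂), (y - x)⁻¹ * g y)
      + -((2 * Real.pi * I : ℂ)⁻¹ * ∮ y in C(0, ρ₁), (y - x)⁻¹ * g y) := by
  have hxA : x ∈ centeredAnnulus r R := ⟨h₁.trans h₂, h₃.trans h₄⟩
  -- The difference quotient has a removable singularity at `x`, so its integrals over the two
  -- circles agree; the formula follows by splitting off the term `g x`.
  have hd : DifferentiableOn ℂ (dslope g x) (centeredAnnulus r R) :=
    (differentiableOn_dslope ((isOpen_centeredAnnulus r R).mem_nhds hxA)).mpr hg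
  have hint : ∀ ρ, 0 < ρ → r < ρ → ρ < R → ‖x‖ ≠ ρ →
      ∮ y in C(0, ρ), dslope g x y =
        (∮ y in C(0, ρ), (y - x)⁻¹ * g y) - g x * ∮ y in C(0, ρ), (y - x)⁻¹ := by
    intro ρ hρ hrρ hρR hxρ
    have hne : ∀ y ∈ sphere (0 : ℂ) ρ, y - x ≠ 0 := fun y hy => by
      rw [sub_ne_zero]
      rintro rfl
      exact hxρ (by simpa using hy)
    have hinv : ContinuousOn (fun y : ℂ => (y - x)⁻¹) (sphere 0 ρ) :=
      ContinuousOn.inv₀ (f := fun y : ℂ => y - x) (by fun_prop) hne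
    rw [← circleIntegral.integral_const_mul, ← circleIntegral.integral_sub]
    · refine circleIntegral.integral_congr hρ.le fun y hy => ?_
      rw [dslope_of_ne _ (sub_ne_zero.mp (hne y hy)), slope_def_field]
      field_simp
    · exact (hinv.mul (hg.continuousOn.mono
        (sphere_subset_centeredAnnulus hrρ hρR))).circleIntegrable hρ.le
    · exact (continuousOn_const.mul hinv).circleIntegrable hρ.le
  have hρ₁ : 0 < ρ₁ := hr.trans_lt h₁
  have e := circleIntegral_eq_of_differentiableOn_annulus hr hd
    (ρ₁ := ρ₁) (ρ₂ := ρ₂) ⟨h₁, h₂.trans (h₃.trans h₄)⟩ ⟨h₁.trans (h₂.trans h₃), h₄⟩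
  rw [hint ρ₁ hρ₁ h₁ (h₂.trans (h₃.trans h₄)) h₂.ne',
    hint ρ₂ (hρ₁.trans (h₂.trans h₃)) (h₁.trans (h₂.trans h₃)) h₄ h₃.ne,
    circleIntegral.integral_sub_inv_of_mem_ball (R := ρ₂) (by simpa using h₃)] at e
  have hz : ∮ y in C(0, ρ₁), (y - x)⁻¹ = 0 := by
    refine DiffContOnCl.circleIntegral_eq_zero hρ₁.le (DifferentiableOn.diffContOnCl ?_)
    rw [closure_ball _ hρ₁.ne']
    refine DifferentiableOn.inv (by fun_prop) fun y hy => ?_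
    rw [sub_ne_zero]
    rintro rfl
    exact (not_le.mpr h₂) (by simpa using hy)
  rw [hz] at e
  have hpi : (2 * Real.pi * I : ℂ) ≠ 0 := Complex.two_pi_I_ne_zero
  rw [← mul_neg, ← mul_add, eq_inv_mul_iff_mul_eq₀ hpi]
  linear_combination e

end Laurent

/-! ### Creative telescoping by a dimension count. -/

section Telescoping

/-- Numerators of the derivatives of `f * N l / E ^ (l + 1)` when `E * f' = M * f`: the `k`-th
derivative is `f * derivNumer E M N l k / E ^ (l + k + 1)`. -/
noncomputable def derivNumer {A : Type*} [CommRing A] (E M : A[X]) (N : ℕ → A[X]) (l : ℕ) :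
    ℕ → A[X]
  | 0 => N l
  | k + 1 => M * derivNumer E M N l k + E * derivative (derivNumer E M N l k)
      - (l + k + 1 : ℕ) • (derivative E * derivNumer E M N l k)

theorem derivNumer_map {A B : Type*} [CommRing A] [CommRing B] (ev : A →+* B) (E M : A[X])
    (N : ℕ → A[X]) (l k : ℕ) :
    (derivNumer E M N l k).map ev =
      derivNumer (E.map ev) (M.map ev) (fun l => (N l).map ev) l k := by
  induction k with
  | zero => rfl
  | succ k ih => simp [derivNumer, ← ih, derivative_map]

theorem natDegree_derivNumer_le {A : Type*} [CommRing A] {E M : A[X]} {N : ℕ → A[X]} {e : ℕ}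
    (hE : E.natDegree ≤ e) (hM : M.natDegree ≤ e) (hN : ∀ l, (N l).natDegree ≤ e * (l + 1))
    (l k : ℕ) : (derivNumer E M N l k).natDegree ≤ e * (l + k + 1) := by
  induction k with
  | zero => exact hN l
  | succ k ih =>
    have h1 : e * (l + (k + 1) + 1) = e + e * (l + k + 1) := by ring
    rw [derivNumer, h1]
    refine (natDegree_sub_le _ _).trans (max_le ((natDegree_add_le _ _).trans (max_le ?_ ?_)) ?_)
    · exact natDegree_mul_le_of_le hM ih
    · exact natDegree_mul_le_of_le hE ((natDegree_derivative_le _).trans (by omega))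
    · refine (natDegree_smul_le _ _).trans (natDegree_mul_le_of_le ?_ ih)
      exact (natDegree_derivative_le _).trans (by omega)

/-- More polynomials than the dimension of the space that contains them are linearly dependent. -/
theorem exists_linearRelation_of_natDegree_lt {A ι : Type*} [CommRing A] [Nontrivial A] [Fintype ι]
    (p : ι → A[X]) {D : ℕ} (hp : ∀ i, (p i).natDegree < D) (hD : D < Fintype.card ι) :
    ∃ c : ι → A, c ≠ 0 ∧ ∑ i, C (c i) * p i = 0 := by
  let v : ι → Fin D → A := fun i j => (p i).coeff j
  have hv : ¬ LinearIndependent A v := fun h => by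
    have := h.fintype_card_le_finrank
    rw [Module.finrank_fin_fun] at this
    omega
  obtain ⟨c, hc, i, hi⟩ := Fintype.not_linearIndependent_iff.mp hv
  refine ⟨c, fun h => hi (congrFun h i), ?_⟩
  ext j
  simp only [finsetSum_coeff, coeff_C_mul, coeff_zero]
  rcases lt_or_ge j D with hj | hj
  · simpa [v] using congrFun hc ⟨j, hj⟩
  · exact Finset.sum_eq_zero fun i _ => by
      rw [coeff_eq_zero_of_natDegree_lt ((hp i).trans_le hj), mul_zero]

/-- The power of `E` brings all `(n+1)²` derivatives to the common denominator `E^(2n+1)`. The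
numerators then have degree at most `e(2n+1)`, linear in `n`, so the quadratic number of them wins.
-/
theorem exists_derivNumer_relation {A : Type*} [CommRing A] [Nontrivial A] (E M : A[X])
    (N : ℕ → A[X]) (hN : ∃ e, ∀ l, (N l).natDegree ≤ e * (l + 1)) :
    ∃ (n : ℕ) (c : Fin (n + 1) × Fin (n + 1) → A), c ≠ 0 ∧
      ∑ i, C (c i) * (derivNumer E M N i.1 i.2 * E ^ (2 * n - i.1 - i.2)) = 0 := by
  obtain ⟨e₀, he₀⟩ := hN
  set e := e₀ + E.natDegree + M.natDegree with he
  -- With `n = 2e + 1` the degree bound is `e(2n+1) = e(4e+3)`, and `(n+1)² = 4e² + 8e + 4` exceeds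
  -- `e(4e+3) + 1`.
  refine ⟨2 * e + 1, exists_linearRelation_of_natDegree_lt (D := e * (4 * e + 3) + 1) _
    (fun i => ?_) ?_⟩
  · have h1 := natDegree_derivNumer_le (E := E) (M := M) (N := N) (e := e) (by omega) (by omega)
      (fun l => (he₀ l).trans (Nat.mul_le_mul_right _ (by omega))) i.1 i.2
    have h2 : (E ^ (2 * (2 * e + 1) - i.1 - i.2 : ℕ)).natDegree ≤
        (2 * (2 * e + 1) - i.1 - i.2) * e :=
      natDegree_pow_le.trans (Nat.mul_le_mul_left _ (by omega))
    refine Nat.lt_succ_of_le ((natDegree_mul_le_of_le h1 h2).trans (le_of_eq ?_))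
    have h3 := i.1.2
    have h4 := i.2.2
    obtain ⟨d, hd⟩ := Nat.exists_eq_add_of_le (show (i.1 : ℕ) + i.2 ≤ 2 * (2 * e + 1) by omega)
    rw [Nat.sub_sub, hd, Nat.add_sub_cancel_left, show 4 * e + 3 = (i.1 + i.2 + d) + 1 by omega]
    ring
  · simp only [Fintype.card_prod, Fintype.card_fin]
    nlinarith

variable {Ω : Set ℂ} {f φ : ℂ → ℂ} {ρ : ℝ}

theorem iteratedDeriv_eq_derivNumer (hΩ : IsOpen Ω) (hf : DifferentiableOn ℂ f Ω) {E M : ℂ[X]}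
    {N : ℕ → ℂ[X]} (hE : ∀ y ∈ Ω, E.eval y ≠ 0)
    (hEM : ∀ y ∈ Ω, E.eval y * deriv f y = M.eval y * f y) {H : ℂ → ℂ} {l : ℕ}
    (hH : ∀ y ∈ Ω, H y = f y * (N l).eval y / E.eval y ^ (l + 1)) (k : ℕ) :
    ∀ y ∈ Ω, iteratedDeriv k H y =
      f y * (derivNumer E M N l k).eval y / E.eval y ^ (l + k + 1) := by
  induction k with
  | zero => simpa [derivNumer] using hH
  | succ k ih =>
    intro y hy
    have heq : iteratedDeriv k H =ᶠ[𝓝 y] fun y =>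
        f y * (derivNumer E M N l k).eval y / E.eval y ^ (l + k + 1) := by
      filter_upwards [hΩ.mem_nhds hy] with z hz using ih z hz
    rw [iteratedDeriv_succ, heq.deriv_eq]
    have hfd := (hf.differentiableAt (hΩ.mem_nhds hy)).hasDerivAt
    have h := (hfd.mul ((derivNumer E M N l k).hasDerivAt y)).div
      ((E.hasDerivAt y).pow (l + k + 1)) (pow_ne_zero _ (hE y hy))
    have h' := h.deriv
    simp only [Pi.mul_def, Pi.div_def, Pi.pow_def] at h'
    refine Eq.trans h' ?_
    have hE0 := hE y hy
    have hM := hEM y hy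
    simp only [derivNumer, eval_sub, eval_add, eval_mul, nsmul_eq_mul, eval_natCast,
      Nat.add_sub_cancel]
    rw [div_eq_div_iff (by positivity) (by positivity)]
    generalize eval y E = E₀ at *
    generalize eval y (derivNumer E M N l k) = D₀ at *
    linear_combination (E₀ ^ (l + k + 1) * E₀ ^ (l + k + 1) * D₀) * hM

/-- Integration by parts: the derivative of `y ^ j * φ⁽ᵏ⁾` integrates to zero over a closed circle.
For `j = 0` the truncated exponent is harmless, its factor being zero. -/
theorem circleIntegral_pow_mul_iteratedDeriv_succ (hΩ : IsOpen Ω) (hφ : DifferentiableOn ℂ φ Ω)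
    (hρ : 0 ≤ ρ) (hs : sphere (0 : ℂ) ρ ⊆ Ω) (j k : ℕ) :
    ∮ y in C(0, ρ), y ^ j * iteratedDeriv (k + 1) φ y =
      -(j * ∮ y in C(0, ρ), y ^ (j - 1) * iteratedDeriv k φ y) := by
  have hd : ∀ k, DifferentiableOn ℂ (iteratedDeriv k φ) Ω := fun k => by
    induction k with
    | zero => simpa using hφ
    | succ k ih => rw [iteratedDeriv_succ]; exact ih.deriv hΩ
  have h0 := circleIntegral.integral_eq_zero_of_hasDerivWithinAt
    (f := fun y => y ^ j * iteratedDeriv k φ y) hρ fun y hy =>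
    ((hasDerivAt_pow j y).mul ((hd k).differentiableAt
      (hΩ.mem_nhds (hs hy))).hasDerivAt).hasDerivWithinAt
  have hc : ∀ j k, CircleIntegrable (fun y => y ^ j * iteratedDeriv k φ y) 0 ρ := fun j k =>
    ContinuousOn.circleIntegrable hρ
      ((continuousOn_pow j).mul ((hd k).continuousOn.mono hs))
  have hc' : CircleIntegrable (fun y => (j : ℂ) * (y ^ (j - 1) * iteratedDeriv k φ y)) 0 ρ :=
    (hc (j - 1) k).const_smul (a := (j : ℂ))
  rw [← circleIntegral.integral_const_mul, eq_neg_iff_add_eq_zero, ← circleIntegral.integral_add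
    (hc j (k + 1)) hc']
  refine Eq.trans ?_ h0
  congr 1
  ext y
  rw [← iteratedDeriv_succ]
  ring

theorem circleIntegral_pow_mul_iteratedDeriv_eq_zero (hΩ : IsOpen Ω)
    (hφ : DifferentiableOn ℂ φ Ω) (hρ : 0 ≤ ρ) (hs : sphere (0 : ℂ) ρ ⊆ Ω) {j k : ℕ} (hjk : j < k) :
    ∮ y in C(0, ρ), y ^ j * iteratedDeriv k φ y = 0 := by
  induction k generalizing j with
  | zero => omega
  | succ k ih =>
    rw [circleIntegral_pow_mul_iteratedDeriv_succ hΩ hφ hρ hs]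
    rcases Nat.eq_zero_or_pos j with rfl | hj
    · simp
    · rw [ih (by omega)]; simp

theorem circleIntegral_pow_mul_iteratedDeriv_self (hΩ : IsOpen Ω)
    (hφ : DifferentiableOn ℂ φ Ω) (hρ : 0 ≤ ρ) (hs : sphere (0 : ℂ) ρ ⊆ Ω) (k : ℕ) :
    ∮ y in C(0, ρ), y ^ k * iteratedDeriv k φ y =
      (-1) ^ k * k.factorial * ∮ y in C(0, ρ), φ y := by
  induction k with
  | zero => simp
  | succ k ih =>
    rw [circleIntegral_pow_mul_iteratedDeriv_succ hΩ hφ hρ hs, Nat.add_sub_cancel, ih,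
      Nat.factorial_succ]
    push_cast
    ring

/-- **Creative telescoping** for the integrands `f * N l / E ^ (l + 1)`, where `E * f' = M * f`. -/
theorem exists_telescoper {A : Type*} [CommRing A] [Nontrivial A] (E M : A[X])
    (N : ℕ → A[X]) (hN : ∃ e, ∀ l, (N l).natDegree ≤ e * (l + 1)) :
    ∃ (n : ℕ) (c : Fin (n + 1) → A), c ≠ 0 ∧
      ∀ (ev : A →+* ℂ) (Ω : Set ℂ) (f : ℂ → ℂ) (H : ℕ → ℂ → ℂ) (ρ : ℝ), IsOpen Ω → 0 ≤ ρ →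
        sphere (0 : ℂ) ρ ⊆ Ω → DifferentiableOn ℂ f Ω →
        (∀ y ∈ Ω, (E.map ev).eval y ≠ 0) →
        (∀ y ∈ Ω, (E.map ev).eval y * deriv f y = (M.map ev).eval y * f y) →
        (∀ l, ∀ y ∈ Ω, H l y = f y * ((N l).map ev).eval y / (E.map ev).eval y ^ (l + 1)) →
        ∑ j : Fin (n + 1), ev (c j) * ∮ y in C(0, ρ), H j y = 0 := by
  classical
  obtain ⟨n, c, hc, hrel⟩ := exists_derivNumer_relation E M N hN
  have hex : ∃ k, ∃ hk : k < n + 1, (fun l => c (l, ⟨k, hk⟩)) ≠ 0 := by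
    by_contra! h
    exact hc (funext fun i => congrFun (h i.2 i.2.2) i.1)
  obtain ⟨hk, hk0⟩ := Nat.find_spec hex
  -- Plain integration would keep only the terms with `k = 0`, whose coefficients may all vanish.
  -- The lowest order `k₀` with a nonzero coefficient is used instead, with weight `y ^ k₀`.
  set k₀ := Nat.find hex with hk₀
  have hmin : ∀ l (k : Fin (n + 1)), (k : ℕ) < k₀ → c (l, k) = 0 := fun l k hlt => by
    have := Nat.find_min hex hlt
    push Not at this
    exact congrFun (this k.2) l
  refine ⟨n, fun l => c (l, ⟨k₀, hk⟩), hk0, fun ev Ω f H ρ hΩ hρ hs hf hE hEM hH => ?_⟩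
  have hHd : ∀ l, DifferentiableOn ℂ (H l) Ω := fun l => by
    refine DifferentiableOn.congr (f := fun y =>
      f y * ((N l).map ev).eval y / (E.map ev).eval y ^ (l + 1)) ?_ fun y hy => hH l y hy
    exact (hf.mul (Polynomial.differentiable _).differentiableOn).div
      ((Polynomial.differentiable _).differentiableOn.pow _) fun y hy => pow_ne_zero _ (hE y hy)
  have hsum : ∀ y ∈ Ω, ∑ i : Fin (n + 1) × Fin (n + 1), ev (c i) * iteratedDeriv i.2 (H i.1) y
      = 0 := fun y hy => by
    have h1 := congrArg (fun p => f y * (p.map ev).eval y / (E.map ev).eval y ^ (2 * n + 1)) hrel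
    simp only [Polynomial.map_sum, Polynomial.map_mul, Polynomial.map_pow, map_C, eval_finsetSum,
      eval_mul, eval_C, eval_pow, Polynomial.map_zero, eval_zero, mul_zero, zero_div,
      derivNumer_map] at h1
    rw [← h1, Finset.mul_sum, Finset.sum_div]
    refine Finset.sum_congr rfl fun i _ => ?_
    rw [iteratedDeriv_eq_derivNumer hΩ hf (N := fun l => (N l).map ev) hE hEM (hH i.1)
      i.2 y hy]
    have h3 := i.1.2
    have h4 := i.2.2
    obtain ⟨d, hd⟩ := Nat.exists_eq_add_of_le (show (i.1 : ℕ) + i.2 ≤ 2 * n by omega)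
    rw [Nat.sub_sub, hd, Nat.add_sub_cancel_left]
    have hE0 := hE y hy
    rw [show (i.1 : ℕ) + i.2 + d + 1 = (i.1 + i.2 + 1) + d by ring, pow_add _ _ d]
    field_simp
  have hci : ∀ i : Fin (n + 1) × Fin (n + 1), CircleIntegrable
      (fun y => y ^ k₀ * iteratedDeriv i.2 (H i.1) y) 0 ρ := fun i => by
    have hd : ∀ k, DifferentiableOn ℂ (iteratedDeriv k (H i.1)) Ω := fun k => by
      induction k with
      | zero => simpa using hHd i.1
      | succ k ih => rw [iteratedDeriv_succ]; exact ih.deriv hΩ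
    exact ContinuousOn.circleIntegrable hρ
      ((continuousOn_pow k₀).mul ((hd i.2).continuousOn.mono hs))
  have hint : ∑ i : Fin (n + 1) × Fin (n + 1),
      ev (c i) * ∮ y in C(0, ρ), y ^ k₀ * iteratedDeriv i.2 (H i.1) y = 0 := by
    simp only [← circleIntegral.integral_const_mul]
    have hci' : ∀ i : Fin (n + 1) × Fin (n + 1), CircleIntegrable
        (fun y => ev (c i) * (y ^ k₀ * iteratedDeriv i.2 (H i.1) y)) 0 ρ := fun i =>
      (hci i).const_smul (a := ev (c i))
    rw [← circleIntegral.integral_fun_sum fun i _ => hci' i]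
    have : EqOn (fun y => ∑ i : Fin (n + 1) × Fin (n + 1),
        ev (c i) * (y ^ k₀ * iteratedDeriv i.2 (H i.1) y)) (fun _ => 0) (sphere 0 ρ) :=
      fun y hy => by
        have h := congrArg (y ^ k₀ * ·) (hsum y (hs hy))
        simp only [Finset.mul_sum, mul_zero] at h
        simp only [← h]
        exact Finset.sum_congr rfl fun i _ => by ring
    rw [circleIntegral.integral_congr hρ this]
    simp [circleIntegral]
  -- Orders below `k₀` vanish by minimality and those above by repeated integration by parts; order
  -- `k₀` contributes the nonzero factor `(-1)^k₀ k₀!`.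
  rw [Fintype.sum_prod_type_right, Finset.sum_eq_single ⟨k₀, hk⟩] at hint
  · simp only [circleIntegral_pow_mul_iteratedDeriv_self hΩ (hHd _) hρ hs] at hint
    have hne : ((-1) ^ k₀ * (k₀.factorial : ℂ)) ≠ 0 :=
      mul_ne_zero (pow_ne_zero _ (by norm_num)) (by exact_mod_cast k₀.factorial_ne_zero)
    refine (mul_eq_zero.mp ?_).resolve_left hne
    refine Eq.trans ?_ hint
    rw [Finset.mul_sum]
    exact Finset.sum_congr rfl fun i _ => by ring
  · intro k _ hkk
    refine Finset.sum_eq_zero fun l _ => ?_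
    rcases lt_or_ge (k : ℕ) k₀ with h | h
    · rw [hmin l k h, map_zero, zero_mul]
    · have : k₀ < (k : ℕ) := lt_of_le_of_ne h fun h => hkk (Fin.ext h.symm)
      rw [circleIntegral_pow_mul_iteratedDeriv_eq_zero hΩ (hHd _) hρ hs this, mul_zero]
  · simp

end Telescoping

/-! ### Square roots of rational functions with simple zeros and poles. -/

section SquareRoots

/-- This is the logarithmic derivative of `√(p / q)` cleared of denominators: differentiate `f² q =
p` and multiply by `f q`. It serves for both `y` and `t`. -/
theorem two_mul_mul_deriv_of_sq_mul_eq {f p q : ℂ → ℂ} {p' q' y : ℂ} (hf : DifferentiableAt ℂ f y)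
    (hp : HasDerivAt p p' y) (hq : HasDerivAt q q' y) (h : ∀ᶠ z in 𝓝 y, f z ^ 2 * q z = p z) :
    2 * (p y * q y) * deriv f y = (p' * q y - p y * q') * f y := by
  have h1 := ((hf.hasDerivAt.pow 2).mul hq).unique (hp.congr_of_eventuallyEq h)
  have h2 := h.self_of_nhds
  simp only [Pi.pow_apply, Nat.cast_ofNat, Nat.add_one_sub_one, pow_one] at h1
  rw [← h2, ← h1]
  ring

theorem not_sq_dvd_of_roots_nodup {p : ℂ[X]} (hp : p ≠ 0) (h : p.roots.Nodup) (a : ℂ) :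
    ¬ (X - C a) ^ 2 ∣ p := fun hd => by
  have h1 := (le_rootMultiplicity_iff hp).mpr hd
  have h2 := Multiset.nodup_iff_count_le_one.mp h a
  rw [count_roots] at h2
  omega

theorem not_sq_dvd_of_eval_eq_zero {p : ℂ[X]} {a : ℂ} (h0 : p.eval a = 0)
    (h1 : (derivative p).eval a = 0) : (X - C a) ^ 2 ∣ p := by
  obtain ⟨q, rfl⟩ := dvd_iff_isRoot.mpr h0
  simp only [derivative_mul, derivative_sub, derivative_X, derivative_C, sub_zero, one_mul,
    eval_add, eval_mul, eval_sub, eval_X, eval_C, sub_self, zero_mul, add_zero] at h1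
  rw [pow_two]
  exact mul_dvd_mul_left _ (dvd_iff_isRoot.mpr h1)

variable {p q : ℂ[X]} {Ω : Set ℂ} {f : ℂ → ℂ}

/-- At a zero of `q` the hypothesis only says `f y = 0`, since division by zero gives zero. There
the identity is a limit from nearby points, where `q` does not vanish. -/
theorem sq_mul_eval_eq (hΩ : IsOpen Ω) (hf : ContinuousOn f Ω) (hq : q ≠ 0)
    (h : ∀ y ∈ Ω, f y ^ 2 = p.eval y / q.eval y) : ∀ y ∈ Ω, f y ^ 2 * q.eval y = p.eval y := by
  intro y hy
  have hfy := hf.continuousAt (hΩ.mem_nhds hy)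
  have hc : Tendsto (fun z => f z ^ 2 * q.eval z) (𝓝[≠] y) (𝓝 (f y ^ 2 * q.eval y)) :=
    ((hfy.pow 2).mul q.continuous.continuousAt).tendsto.mono_left nhdsWithin_le_nhds
  have hc' : Tendsto (fun z => p.eval z) (𝓝[≠] y) (𝓝 (p.eval y)) :=
    p.continuous.continuousAt.tendsto.mono_left nhdsWithin_le_nhds
  refine tendsto_nhds_unique_of_eventuallyEq hc hc' ?_
  have h1 : ∀ᶠ z in 𝓝[≠] y, q.eval z ≠ 0 := by
    have hfin : {z | q.eval z = 0}.Finite := by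
      refine (q.roots.toFinset.finite_toSet).subset fun z hz => ?_
      simpa [hq] using hz
    have : ({z | q.eval z = 0} \ {y})ᶜ ∈ 𝓝 y :=
      (hfin.sdiff.isClosed.isOpen_compl).mem_nhds (by simp)
    filter_upwards [mem_nhdsWithin_of_mem_nhds this, self_mem_nhdsWithin] with z hz hzy hz0
    exact hz ⟨hz0, hzy⟩
  filter_upwards [h1, mem_nhdsWithin_of_mem_nhds (hΩ.mem_nhds hy)] with z hz hzΩ
  rw [h z hzΩ, div_mul_cancel₀ _ hz]

/-- A differentiable square root has no branch point. A zero of `q` would also be one of `p`; a zero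
of `p` alone makes `f`, hence `p'`, vanish. Either way `p q` gets a double root. -/
theorem eval_mul_ne_zero_of_sq_mul_eq (hΩ : IsOpen Ω) (hf : DifferentiableOn ℂ f Ω)
    (hpq : p * q ≠ 0) (hroots : (p * q).roots.Nodup)
    (h : ∀ y ∈ Ω, f y ^ 2 * q.eval y = p.eval y) : ∀ y ∈ Ω, p.eval y * q.eval y ≠ 0 := by
  intro y hy h0
  have hfy := (hf.differentiableAt (hΩ.mem_nhds hy)).hasDerivAt
  have hev : ∀ᶠ z in 𝓝 y, f z ^ 2 * q.eval z = p.eval z := by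
    filter_upwards [hΩ.mem_nhds hy] with z hz using h z hz
  have h1 := ((hfy.pow 2).mul (q.hasDerivAt y)).unique
    ((p.hasDerivAt y).congr_of_eventuallyEq hev)
  have h2 := h y hy
  simp only [Pi.pow_apply, Nat.cast_ofNat, Nat.add_one_sub_one, pow_one] at h1
  refine not_sq_dvd_of_roots_nodup hpq hroots y (not_sq_dvd_of_eval_eq_zero (by simpa using h0) ?_)
  rw [derivative_mul, eval_add, eval_mul, eval_mul]
  rcases eq_or_ne (q.eval y) 0 with hq | hq
  · rw [hq, mul_zero] at h2
    rw [hq, ← h2, mul_zero, zero_mul, zero_add]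
  · have hp := (mul_eq_zero.mp h0).resolve_right hq
    rw [hp] at h2
    have hf0 : f y = 0 := pow_eq_zero_iff (two_ne_zero) |>.mp ((mul_eq_zero.mp h2).resolve_right hq)
    rw [hf0] at h1
    rw [hp, ← h1]
    ring

end SquareRoots

/-! ### Parameter derivatives and change of coefficient ring. -/

section Bivariate

/-- Evaluation of `c(x, t)` as a ring homomorphism. -/
noncomputable def evalAt (x t : ℂ) : ℂ[X][X] →+* ℂ :=
  (evalRingHom x).comp (mapRingHom (evalRingHom t))

theorem evalAt_apply (x t : ℂ) (c : ℂ[X][X]) : evalAt x t c = (specializeAt c t).eval x := rfl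

/-- `P(y, t)` as a polynomial in a new variable `y` with coefficients in `ℂ[x, t]`. -/
noncomputable def newVariable (P : ℂ[X][X]) : ℂ[X][X][X] := P.map C

theorem newVariable_map_evalAt (P : ℂ[X][X]) (x t : ℂ) :
    (newVariable P).map (evalAt x t) = specializeAt P t := by
  rw [newVariable, Polynomial.map_map, specializeAt]
  congr 1
  ext
  · simp [evalAt]
  · simp [evalAt]

theorem natDegree_newVariable_le (P : ℂ[X][X]) : (newVariable P).natDegree ≤ P.natDegree :=
  natDegree_map_le

theorem exists_hasDerivAt_specializeAt (P : ℂ[X][X]) :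
    ∃ P' : ℂ[X][X], P'.natDegree ≤ P.natDegree ∧ ∀ x t : ℂ,
      HasDerivAt (fun t => (specializeAt P t).eval x) ((specializeAt P' t).eval x) t := by
  refine ⟨∑ i ∈ Finset.range (P.natDegree + 1), monomial i (derivative (P.coeff i)),
    natDegree_sum_le_of_forall_le _ _ fun i hi => (natDegree_monomial_le _).trans (by
      simpa [Nat.lt_succ_iff] using hi), fun x t => ?_⟩
  have h1 : (fun t => (specializeAt P t).eval x) = fun t =>
      ∑ i ∈ Finset.range (P.natDegree + 1), (P.coeff i).eval t * x ^ i := by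
    ext t
    rw [specializeAt, eval_map, eval₂_eq_sum_range]
    rfl
  rw [h1]
  simp only [specializeAt, Polynomial.map_sum, map_monomial, eval_finsetSum, eval_monomial,
    coe_evalRingHom]
  exact HasDerivAt.fun_sum fun i _ => ((P.coeff i).hasDerivAt t).mul_const _

theorem specializeAt_mul (P Q : ℂ[X][X]) (t : ℂ) :
    specializeAt (P * Q) t = specializeAt P t * specializeAt Q t := Polynomial.map_mul _

/-- With `S = P Q` and `V = P_t Q - P Q_t` one has `2 S f_t = V f`, so each `t`-derivative of `f` is
a rational multiple of `f`. Differentiating in `t` does not raise the degree in `y`, so that degree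
grows linearly in `l`. -/
theorem exists_iteratedDeriv_snd_numerators (P Q : ℂ[X][X]) :
    ∃ (n : ℕ → ℂ[X][X]) (e : ℕ), (∀ l, (n l).natDegree ≤ e * l) ∧
      ∀ (y : ℂ) (T : Set ℂ) (f : ℂ → ℂ), IsOpen T → DifferentiableOn ℂ f T →
        (∀ t ∈ T, f t ^ 2 * (specializeAt Q t).eval y = (specializeAt P t).eval y) →
        (∀ t ∈ T, (specializeAt P t).eval y * (specializeAt Q t).eval y ≠ 0) →
        ∀ l, ∀ t ∈ T, iteratedDeriv l f t = f t * (specializeAt (n l) t).eval y /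
          (2 * ((specializeAt P t).eval y * (specializeAt Q t).eval y)) ^ l := by
  choose D hDdeg hD using exists_hasDerivAt_specializeAt
  let S : ℂ[X][X] := P * Q
  let V : ℂ[X][X] := D P * Q - P * D Q
  -- The recursion is the quotient rule for `f n_l / (2S)^l` with `f_t` replaced by `V f / (2S)`.
  let n : ℕ → ℂ[X][X] := fun l => Nat.rec 1 (fun l m => V * m + 2 * S * D m
    - 2 * (l : ℂ[X][X]) * D S * m) l
  have hn : ∀ l, n (l + 1) = V * n l + 2 * S * D (n l) - 2 * (l : ℂ[X][X]) * D S * n l :=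
    fun l => rfl
  refine ⟨n, V.natDegree + S.natDegree, fun l => ?_, fun y T f hT hf hfS hS l => ?_⟩
  · induction l with
    | zero => simp [n]
    | succ l ih =>
      have h1 : (V.natDegree + S.natDegree) * (l + 1) =
        (V.natDegree + S.natDegree) + (V.natDegree + S.natDegree) * l := by ring
      rw [hn, h1]
      have h2 : (2 * S).natDegree ≤ V.natDegree + S.natDegree := by
        rw [← C_ofNat]
        exact (natDegree_C_mul_le _ _).trans (by omega)
      have h3 : (2 * (l : ℂ[X][X]) * D S).natDegree ≤ V.natDegree + S.natDegree := by
        have : (2 * (l : ℂ[X][X])) = C (2 * (l : ℂ[X])) := by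
          rw [C_mul, C_ofNat, map_natCast]
        rw [this]
        exact (natDegree_C_mul_le _ _).trans ((hDdeg S).trans (by omega))
      refine (natDegree_sub_le _ _).trans (max_le ((natDegree_add_le _ _).trans (max_le ?_ ?_)) ?_)
      · exact natDegree_mul_le_of_le (by omega) ih
      · exact natDegree_mul_le_of_le h2 ((hDdeg _).trans ih)
      · exact natDegree_mul_le_of_le h3 ih
  · induction l with
    | zero => intro t _; simp [n, specializeAt]
    | succ l ih =>
      intro t ht
      have heq : iteratedDeriv l f =ᶠ[𝓝 t] fun t => f t * (specializeAt (n l) t).eval y /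
          (2 * (specializeAt S t).eval y) ^ l := by
        filter_upwards [hT.mem_nhds ht] with z hz
        rw [ih z hz, specializeAt_mul, eval_mul]
      have hfd := hf.differentiableAt (hT.mem_nhds ht)
      have hS0 : (specializeAt S t).eval y ≠ 0 := by
        rw [specializeAt_mul, eval_mul]; exact hS t ht
      rw [iteratedDeriv_succ, heq.deriv_eq]
      have h := (hfd.hasDerivAt.mul (hD (n l) y t)).div
        (((hD S y t).const_mul 2).pow l) (pow_ne_zero l (mul_ne_zero two_ne_zero hS0))
      have h' := h.deriv
      simp only [Pi.mul_def, Pi.div_def, Pi.pow_def] at h'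
      refine Eq.trans h' ?_
      have hM := two_mul_mul_deriv_of_sq_mul_eq hfd (hD P y t) (hD Q y t) (by
        filter_upwards [hT.mem_nhds ht] with z hz using hfS z hz)
      have hV : (specializeAt V t).eval y = (specializeAt (D P) t).eval y *
          (specializeAt Q t).eval y - (specializeAt P t).eval y * (specializeAt (D Q) t).eval y := by
        simp [V, specializeAt]
      have hS' : (specializeAt P t).eval y * (specializeAt Q t).eval y =
          (specializeAt S t).eval y := by
        simp [S, specializeAt]
      have hn' : (specializeAt (n (l + 1)) t).eval y = (specializeAt V t).eval y *
          (specializeAt (n l) t).eval y + 2 * (specializeAt S t).eval y *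
          (specializeAt (D (n l)) t).eval y - 2 * l * (specializeAt (D S) t).eval y *
          (specializeAt (n l) t).eval y := by
        rw [hn]; simp [specializeAt]
      rw [← hV, hS'] at hM
      rw [hS', hn']
      generalize (specializeAt S t).eval y = s at *
      generalize (specializeAt (n l) t).eval y = m at *
      have h2s : 2 * s ≠ 0 := mul_ne_zero two_ne_zero hS0
      rw [div_eq_div_iff (pow_ne_zero _ (pow_ne_zero _ h2s)) (pow_ne_zero _ h2s)]
      -- The power rule produces the truncated exponent `l - 1`, so `l = 0` is treated apart.
      rcases l with _ | l
      · simp only [pow_zero, Nat.cast_zero]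
        linear_combination m * hM
      · simp only [Nat.add_sub_cancel]
        linear_combination (((2 * s) ^ (l + 1)) * ((2 * s) ^ (l + 1)) * m) * hM

end Bivariate

/-! ### Differential equations for the Cauchy transform. -/

section DFinite

/-- `f` is an analytic branch of `√(P / Q)` on the open set `W`, over parameters where `P / Q`
has distinct zeros and poles. -/
structure IsSqrtBranch (P Q : ℂ[X][X]) (f : ℂ × ℂ → ℂ) (W : Set (ℂ × ℂ)) : Prop where
  isOpen : IsOpen W
  analytic : AnalyticOnNhd ℂ f W
  distinct : ∀ p ∈ W, HasDistinctZerosAndPoles P Q p.2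
  sq_eq : ∀ p ∈ W, f p ^ 2 = ratEval P Q p.1 p.2

namespace IsSqrtBranch

variable {P Q : ℂ[X][X]} {f : ℂ × ℂ → ℂ} {W : Set (ℂ × ℂ)} (hf : IsSqrtBranch P Q f W)
include hf

theorem isOpen_fst (t : ℂ) : IsOpen {y | (y, t) ∈ W} := hf.isOpen.preimage (by fun_prop)

theorem isOpen_snd (y : ℂ) : IsOpen {t | (y, t) ∈ W} := hf.isOpen.preimage (by fun_prop)

theorem differentiableOn_fst (t : ℂ) : DifferentiableOn ℂ (fun y => f (y, t)) {y | (y, t) ∈ W} :=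
  fun y hy => ((hf.analytic _ hy).differentiableAt.comp y
    (f := fun y : ℂ => (y, t)) (by fun_prop)).differentiableWithinAt

theorem differentiableOn_snd (y : ℂ) : DifferentiableOn ℂ (fun t => f (y, t)) {t | (y, t) ∈ W} :=
  fun t ht => ((hf.analytic _ ht).differentiableAt.comp t
    (f := fun t : ℂ => (y, t)) (by fun_prop)).differentiableWithinAt

theorem sq_mul_eq {y t : ℂ} (h : (y, t) ∈ W) :
    f (y, t) ^ 2 * (specializeAt Q t).eval y = (specializeAt P t).eval y :=
  sq_mul_eval_eq (p := specializeAt P t) (q := specializeAt Q t) (hf.isOpen_fst t) (hf.differentiableOn_fst t).continuousOn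
    (right_ne_zero_of_mul (hf.distinct _ h).1) (fun _ hz => hf.sq_eq _ hz) y h

theorem mul_ne_zero {y t : ℂ} (h : (y, t) ∈ W) :
    (specializeAt P t).eval y * (specializeAt Q t).eval y ≠ 0 :=
  eval_mul_ne_zero_of_sq_mul_eq (hf.isOpen_fst t) (hf.differentiableOn_fst t)
    (hf.distinct _ h).1 (hf.distinct _ h).2 (fun _ hz => hf.sq_mul_eq hz) y h

end IsSqrtBranch

/-- The denominator `2 P Q (y - x)` of the logarithmic `y`-derivative of the integrand. -/
noncomputable def kernelDenom (P Q : ℂ[X][X]) : ℂ[X][X][X] :=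
  newVariable (2 * (P * Q)) * (X - C X)

/-- The numerator of the logarithmic `y`-derivative of `√(P / Q)` over `kernelDenom P Q`. -/
noncomputable def kernelNumer (P Q : ℂ[X][X]) : ℂ[X][X][X] :=
  newVariable (derivative P * Q - P * derivative Q) * (X - C X)

theorem natDegree_X_sub_C_X_pow_le (l : ℕ) :
    ((X - C X : ℂ[X][X][X]) ^ l).natDegree ≤ l := by
  simp

theorem eval_kernelDenom (P Q : ℂ[X][X]) (x t y : ℂ) :
    ((kernelDenom P Q).map (evalAt x t)).eval y =
      2 * ((specializeAt P t).eval y * (specializeAt Q t).eval y) * (y - x) := by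
  rw [kernelDenom, Polynomial.map_mul, newVariable_map_evalAt]
  simp [specializeAt, evalAt]

theorem eval_kernelNumer (P Q : ℂ[X][X]) (x t y : ℂ) :
    ((kernelNumer P Q).map (evalAt x t)).eval y =
      ((derivative (specializeAt P t)).eval y * (specializeAt Q t).eval y -
        (specializeAt P t).eval y * (derivative (specializeAt Q t)).eval y) * (y - x) := by
  rw [kernelNumer, Polynomial.map_mul, newVariable_map_evalAt]
  simp [specializeAt, evalAt, derivative_map]

variable {P Q : ℂ[X][X]} {f : ℂ × ℂ → ℂ} {W : Set (ℂ × ℂ)}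

/-- A telescoper annihilates the derivatives of the Cauchy transform when these are the integrals
of `f * N l / kernelDenom ^ (l + 1)`. -/
theorem IsSqrtBranch.exists_annihilator (hf : IsSqrtBranch P Q f W) (N : ℕ → ℂ[X][X][X])
    (hN : ∃ e, ∀ l, (N l).natDegree ≤ e * (l + 1)) (H : ℕ → ℂ → ℂ → ℂ → ℂ)
    (hH : ∀ l x t y, (y, t) ∈ W → y ≠ x → H l x t y = f (y, t) * ((N l).map (evalAt x t)).eval y /
      ((kernelDenom P Q).map (evalAt x t)).eval y ^ (l + 1)) :
    ∃ (n : ℕ) (c : Fin (n + 1) → ℂ[X][X]), c ≠ 0 ∧ ∀ (x t : ℂ) (ρ : ℝ), 0 < ρ → ‖x‖ ≠ ρ →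
      (∀ y ∈ sphere (0 : ℂ) ρ, (y, t) ∈ W) →
      ∑ j : Fin (n + 1), (specializeAt (c j) t).eval x *
        ((2 * Real.pi * I : ℂ)⁻¹ * ∮ y in C(0, ρ), H j x t y) = 0 := by
  obtain ⟨n, c, hc, h⟩ := exists_telescoper (kernelDenom P Q) (kernelNumer P Q) N hN
  refine ⟨n, c, hc, fun x t ρ hρ hxρ hsW => ?_⟩
  have hs : sphere (0 : ℂ) ρ ⊆ {y | (y, t) ∈ W} ∩ {y | y ≠ x} := fun y hy =>
    ⟨hsW y hy, by rintro rfl; exact hxρ (by simpa using hy)⟩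
  have key := h (evalAt x t) ({y | (y, t) ∈ W} ∩ {y | y ≠ x}) (fun y => f (y, t))
    (fun l y => H l x t y) ρ ((hf.isOpen_fst t).inter isOpen_ne) hρ.le hs
    ((hf.differentiableOn_fst t).mono inter_subset_left) ?_ ?_ ?_
  · have h2 := congrArg ((2 * Real.pi * I : ℂ)⁻¹ * ·) key
    simp only [Finset.mul_sum, mul_zero] at h2
    refine Eq.trans (Finset.sum_congr rfl fun j _ => ?_) h2
    rw [← evalAt_apply]
    ring
  · intro y hy
    rw [eval_kernelDenom]
    exact _root_.mul_ne_zero (_root_.mul_ne_zero two_ne_zero (hf.mul_ne_zero hy.1))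
      (sub_ne_zero.mpr hy.2)
  · intro y hy
    have := two_mul_mul_deriv_of_sq_mul_eq (f := fun y => f (y, t))
      ((hf.differentiableOn_fst t).differentiableAt ((hf.isOpen_fst t).mem_nhds hy.1))
      ((specializeAt P t).hasDerivAt y) ((specializeAt Q t).hasDerivAt y) (by
        filter_upwards [(hf.isOpen_fst t).mem_nhds hy.1] with z hz using hf.sq_mul_eq hz)
    rw [eval_kernelDenom, eval_kernelNumer]
    linear_combination (y - x) * this
  · exact fun l y hy => hH l x t y hy.1 hy.2

/-- The `x`-derivatives fall on the kernel alone and give `l! f / (y - x)^(l+1)`; the power of `2PQ`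
in the numerator only matches the denominator `E^(l+1)`. -/
theorem IsSqrtBranch.exists_equation_fst (hf : IsSqrtBranch P Q f W) :
    ∃ (n : ℕ) (c : Fin (n + 1) → ℂ[X][X]), c ≠ 0 ∧ ∀ (x t : ℂ) (ρ : ℝ), 0 < ρ → ‖x‖ ≠ ρ →
      (∀ y ∈ sphere (0 : ℂ) ρ, (y, t) ∈ W) →
      ∑ j : Fin (n + 1), (specializeAt (c j) t).eval x *
        iteratedDeriv (j : ℕ) (fun x => cauchyTransform f ρ (x, t)) x = 0 := by
  obtain ⟨n, c, hc, h⟩ := hf.exists_annihilator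
    (fun l => (l.factorial : ℂ[X][X][X]) * newVariable (2 * (P * Q)) ^ (l + 1))
    ⟨(newVariable (2 * (P * Q))).natDegree, fun l => by
      rw [mul_comm _ (l + 1)]
      refine (natDegree_mul_le_of_le (natDegree_natCast _).le natDegree_pow_le).trans (by simp)⟩
    (fun l x t y => (l.factorial * ((y - x) ^ (l + 1))⁻¹) * f (y, t)) (fun l x t y hy hxy => by
      rw [eval_kernelDenom, Polynomial.map_mul, Polynomial.map_pow, newVariable_map_evalAt,
        specializeAt_mul, specializeAt_mul, eval_mul, eval_pow, eval_mul, eval_mul]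
      have h1 := hf.mul_ne_zero hy
      have h2 : y - x ≠ 0 := sub_ne_zero.mpr hxy
      have h3 : (specializeAt 2 t).eval y = 2 := by simp [specializeAt]
      rw [h3, Polynomial.map_natCast, eval_natCast, mul_pow _ (y - x)]
      have h4 := _root_.mul_ne_zero (two_ne_zero (α := ℂ)) h1
      generalize 2 * ((specializeAt P t).eval y * (specializeAt Q t).eval y) = s at *
      field_simp)
  refine ⟨n, c, hc, fun x t ρ hρ hxρ hsW => ?_⟩
  simp only [iteratedDeriv_cauchyTransform_fst hf.isOpen hf.analytic hρ hxρ hsW]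
  exact h x t ρ hρ hxρ hsW

/-- The `t`-derivatives fall on `f` alone and give `f m_l / ((2PQ)^l (y - x))`; the factor `2PQ (y -
x)^l` in the numerator completes the denominator to `E^(l+1)`. -/
theorem IsSqrtBranch.exists_equation_snd (hf : IsSqrtBranch P Q f W) :
    ∃ (n : ℕ) (c : Fin (n + 1) → ℂ[X][X]), c ≠ 0 ∧ ∀ (x t : ℂ) (ρ : ℝ), 0 < ρ → ‖x‖ ≠ ρ →
      (∀ y ∈ sphere (0 : ℂ) ρ, (y, t) ∈ W) →
      ∑ j : Fin (n + 1), (specializeAt (c j) t).eval x *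
        iteratedDeriv (j : ℕ) (fun t => cauchyTransform f ρ (x, t)) t = 0 := by
  obtain ⟨m, e, hm, hmf⟩ := exists_iteratedDeriv_snd_numerators P Q
  obtain ⟨n, c, hc, h⟩ := hf.exists_annihilator
    (fun l => newVariable (m l * (2 * (P * Q))) * (X - C X) ^ l)
    ⟨e + (2 * (P * Q)).natDegree + 1, fun l => by
      refine (natDegree_mul_le_of_le ((natDegree_newVariable_le _).trans
        (natDegree_mul_le_of_le (hm l) le_rfl)) (natDegree_X_sub_C_X_pow_le l)).trans ?_
      nlinarith [Nat.zero_le ((2 * (P * Q)).natDegree * l)]⟩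
    (fun l x t y => (y - x)⁻¹ * iteratedDeriv l (fun t => f (y, t)) t) (fun l x t y hy hxy => by
      rw [hmf y {t | (y, t) ∈ W} (fun t => f (y, t)) (hf.isOpen_snd y) (hf.differentiableOn_snd y)
        (fun t ht => hf.sq_mul_eq ht) (fun t ht => hf.mul_ne_zero ht) l t hy,
        eval_kernelDenom, Polynomial.map_mul, newVariable_map_evalAt, specializeAt_mul,
        specializeAt_mul, specializeAt_mul, eval_mul, eval_mul, eval_mul, eval_mul]
      have h1 := hf.mul_ne_zero hy
      have h2 : y - x ≠ 0 := sub_ne_zero.mpr hxy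
      have h3 : (specializeAt 2 t).eval y = 2 := by simp [specializeAt]
      have h5 : (((X - C X : ℂ[X][X][X]) ^ l).map (evalAt x t)).eval y = (y - x) ^ l := by
        simp [evalAt]
      rw [h3, h5, mul_pow _ (y - x)]
      have h4 := _root_.mul_ne_zero (two_ne_zero (α := ℂ)) h1
      generalize 2 * ((specializeAt P t).eval y * (specializeAt Q t).eval y) = s at *
      field_simp
      ring)
  refine ⟨n, c, hc, fun x t ρ hρ hxρ hsW => ?_⟩
  simp only [iteratedDeriv_cauchyTransform_snd hf.isOpen hf.analytic hρ hxρ hsW]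
  exact h x t ρ hρ hxρ hsW

end DFinite

/-! ### Singularities force infinitely many Laurent terms. -/

section Singularities

/-- The set is the image under `exp` of a convex set, described by a condition on the real part. -/
theorem isPreconnected_setOf_lt_norm {r : ℝ} : IsPreconnected {x : ℂ | x ≠ 0 ∧ r < ‖x‖} := by
  have hconv : Convex ℝ {z : ℂ | r < Real.exp z.re} := by
    have : OrdConnected {u : ℝ | r < Real.exp u} :=
      ⟨fun a ha b _ c hc => lt_of_lt_of_le (mem_ofPred.mp ha) (Real.exp_le_exp.mpr hc.1)⟩
    exact this.convex.is_linear_preimage (f := Complex.re)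
      ⟨fun _ _ => Complex.add_re _ _, fun _ _ => by simp⟩
  have himg : Complex.exp '' {z : ℂ | r < Real.exp z.re} = {x : ℂ | x ≠ 0 ∧ r < ‖x‖} := by
    ext x
    constructor
    · rintro ⟨z, hz, rfl⟩
      exact ⟨Complex.exp_ne_zero z, by rwa [Complex.norm_exp]⟩
    · rintro ⟨h0, hx⟩
      refine ⟨Complex.log x, ?_, Complex.exp_log h0⟩
      rw [mem_ofPred, ← Complex.norm_exp, Complex.exp_log h0]
      exact hx
  rw [← himg]
  exact hconv.isPreconnected.image _ Complex.continuous_exp.continuousOn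

variable {p q : ℂ[X]} {F : ℂ → ℂ} {V : Set ℂ} {x₀ z₀ : ℂ}

theorem AnalyticOnNhd.sq_mul_eq_of_eventuallyEq (hV : IsPreconnected V) (hF : AnalyticOnNhd ℂ F V)
    (hz : z₀ ∈ V) (h : ∀ᶠ z in 𝓝 z₀, F z ^ 2 * q.eval z = p.eval z) :
    ∀ x ∈ V, F x ^ 2 * q.eval x = p.eval x := by
  have hpoly : ∀ p : ℂ[X], AnalyticOnNhd ℂ (fun x => p.eval x) V := fun p x _ =>
    (Polynomial.differentiable p).analyticAt x
  exact ((hF.pow 2).mul (hpoly q)).eqOn_of_preconnected_of_eventuallyEq (hpoly p) hV hz h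

theorem not_isSingularityOfSqrt (hVo : IsOpen V) (hV : IsPreconnected V)
    (hF : AnalyticOnNhd ℂ F V) (hz : z₀ ∈ V)
    (h : ∀ᶠ z in 𝓝 z₀, F z ^ 2 * q.eval z = p.eval z) (hq : q ≠ 0) (hx : x₀ ∈ V) :
    ¬ IsSingularityOfSqrt (fun x => p.eval x / q.eval x) x₀ := by
  refine not_not.mpr ⟨F, hF x₀ hx, ?_⟩
  have hfin : {z | q.eval z = 0}.Finite := by
    refine (q.roots.toFinset.finite_toSet).subset fun z hz => ?_
    simpa [hq] using hz
  have hnhds : ({z | q.eval z = 0} \ {x₀})ᶜ ∈ 𝓝 x₀ :=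
    (hfin.sdiff.isClosed.isOpen_compl).mem_nhds (by simp)
  filter_upwards [mem_nhdsWithin_of_mem_nhds hnhds, self_mem_nhdsWithin,
    mem_nhdsWithin_of_mem_nhds (hVo.mem_nhds hx)] with z hz1 hz2 hz3
  have hq0 : q.eval z ≠ 0 := fun h0 => hz1 ⟨h0, hz2⟩
  rw [eq_div_iff hq0]
  exact hF.sq_mul_eq_of_eventuallyEq hV hz h z hz3

/-- The denominator of a square has no simple zero at a pole of even order. -/
theorem false_of_sq_mul_eq_pow_mul (hV : IsPreconnected V)
    (hF : AnalyticOnNhd ℂ F V) (hz : z₀ ∈ V) {m : ℕ} (hm : 0 < m)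
    (h : ∀ᶠ z in 𝓝 z₀, F z ^ 2 * q.eval z = (z ^ m) ^ 2 * p.eval z)
    (h0 : (0 : ℂ) ∈ V) (hVo : IsOpen V) (hF0 : F 0 ≠ 0) (hpq : p * q ≠ 0)
    (hroots : (p * q).roots.Nodup) : False := by
  have h' : ∀ᶠ z in 𝓝 z₀, F z ^ 2 * q.eval z = ((X ^ m) ^ 2 * p).eval z := by
    simpa using h
  have key := hF.sq_mul_eq_of_eventuallyEq hV hz h'
  have e0 := key 0 h0
  simp only [eval_mul, eval_pow, eval_X, zero_pow hm.ne', ne_eq, OfNat.ofNat_ne_zero,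
    not_false_eq_true, zero_pow, zero_mul] at e0
  have hq0 : q.eval 0 = 0 := (mul_eq_zero.mp e0).resolve_left (pow_ne_zero 2 hF0)
  have hev : ∀ᶠ z in 𝓝 (0 : ℂ), F z ^ 2 * q.eval z = ((X ^ m) ^ 2 * p).eval z := by
    filter_upwards [hVo.mem_nhds h0] with z hz using key z hz
  -- Since `q 0 = 0`, comparing derivatives at `0` leaves `F(0)² q'(0) = 0`, so `0` is a double root
  -- of `q`.
  have e1 := (((hF 0 h0).differentiableAt.hasDerivAt.pow 2).mul (q.hasDerivAt 0)).unique
    ((((X ^ m) ^ 2 * p).hasDerivAt 0).congr_of_eventuallyEq hev)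
  have hd : (derivative ((X ^ m) ^ 2 * p)).eval 0 = 0 := by
    simp [derivative_mul, derivative_pow, hm.ne']
  rw [hq0, mul_zero, zero_add, hd] at e1
  have hq1 : (derivative q).eval 0 = 0 := (mul_eq_zero.mp e1).resolve_left (pow_ne_zero 2 hF0)
  exact not_sq_dvd_of_roots_nodup hpq hroots 0
    (Dvd.dvd.mul_left (not_sq_dvd_of_eval_eq_zero hq0 hq1) p)

variable {r R : ℝ} {f A B : ℂ → ℂ} {a : ℤ → ℂ}

theorem infinite_pos_of_isSingularityOfSqrt (hr : 0 ≤ r) (hrR : r < R)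
    (hB : AnalyticOnNhd ℂ B {x | r < ‖x‖})
    (hA : ∀ x ∈ centeredAnnulus r R, HasLaurentSum (laurentNonnegPart a) x (A x))
    (hfAB : ∀ x ∈ centeredAnnulus r R, f x = A x + B x)
    (hf : ∀ x ∈ centeredAnnulus r R, f x ^ 2 * q.eval x = p.eval x) (hq : q ≠ 0)
    (hx : R ≤ ‖x₀‖) (hsing : IsSingularityOfSqrt (fun x => p.eval x / q.eval x) x₀) :
    {i : ℤ | 0 < i ∧ a i ≠ 0}.Infinite := by
  intro hfin
  have hV : {x : ℂ | r < ‖x‖} = {x : ℂ | x ≠ 0 ∧ r < ‖x‖} := by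
    ext x
    exact ⟨fun h => ⟨norm_pos_iff.mp (hr.trans_lt h), h⟩, fun h => h.2⟩
  -- Degree `0` belongs to `A` but not to the set assumed finite.
  let s : Finset ℤ := insert 0 hfin.toFinset
  have hAs : ∀ x ∈ centeredAnnulus r R, A x = ∑ i ∈ s, laurentNonnegPart a i * x ^ i := by
    intro x hx
    refine (hA x hx).unique (hasSum_sum_of_ne_finset_zero fun i hi => ?_)
    simp only [s, Finset.mem_insert, Finite.mem_toFinset, mem_ofPred, not_or, not_and, not_not] at hi
    rcases lt_trichotomy i 0 with h | h | h
    · simp [laurentNonnegPart, not_le.mpr h]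
    · exact absurd h hi.1
    · simp [laurentNonnegPart, hi.2 h]
  -- This continues `f` to the whole exterior; by the identity theorem its square is still `p / q`
  -- there, even at the presumed singularity.
  have hF : AnalyticOnNhd ℂ (fun x => (∑ i ∈ s, laurentNonnegPart a i * x ^ i) + B x)
      {x | r < ‖x‖} := fun x hx => by
    refine AnalyticAt.add ?_ (hB x hx)
    refine Finset.analyticAt_fun_sum _ fun i _ => analyticAt_const.mul ?_
    exact analyticAt_id.zpow (norm_pos_iff.mp (hr.trans_lt hx))
  have hz : (((r + R) / 2 : ℝ) : ℂ) ∈ centeredAnnulus r R := by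
    rw [centeredAnnulus, mem_ofPred, Complex.norm_real, Real.norm_of_nonneg (by linarith)]
    constructor <;> linarith
  refine not_isSingularityOfSqrt (V := {x : ℂ | r < ‖x‖})
    (isOpen_lt continuous_const continuous_norm) (hV ▸ isPreconnected_setOf_lt_norm) hF
    (z₀ := (((r + R) / 2 : ℝ) : ℂ)) hz.1 ?_ hq (hrR.trans_le hx) hsing
  filter_upwards [(isOpen_centeredAnnulus r R).mem_nhds hz] with z hz
  rw [← hAs z hz, ← hfAB z hz, hf z hz]

theorem infinite_neg_of_isSingularityOfSqrt (hr : 0 ≤ r) (hrR : r < R)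
    (hA : AnalyticOnNhd ℂ A {x | ‖x‖ < R})
    (hB : ∀ x ∈ centeredAnnulus r R, HasLaurentSum (laurentNegPart a) x (B x))
    (hfAB : ∀ x ∈ centeredAnnulus r R, f x = A x + B x)
    (hf : ∀ x ∈ centeredAnnulus r R, f x ^ 2 * q.eval x = p.eval x) (hpq : p * q ≠ 0)
    (hroots : (p * q).roots.Nodup)
    (hx : ‖x₀‖ ≤ r) (hsing : IsSingularityOfSqrt (fun x => p.eval x / q.eval x) x₀) :
    {i : ℤ | i < 0 ∧ a i ≠ 0}.Infinite := by
  intro hfin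
  have hz : (((r + R) / 2 : ℝ) : ℂ) ∈ centeredAnnulus r R := by
    rw [centeredAnnulus, mem_ofPred, Complex.norm_real, Real.norm_of_nonneg (by linarith)]
    constructor <;> linarith
  have hVo : IsOpen {x : ℂ | ‖x‖ < R} := isOpen_lt continuous_norm continuous_const
  have hV : IsPreconnected {x : ℂ | ‖x‖ < R} := by
    have : {x : ℂ | ‖x‖ < R} = ball 0 R := by ext; simp
    rw [this]
    exact (convex_ball 0 R).isPreconnected
  set s : Finset ℤ := hfin.toFinset with hs
  have hmem : ∀ i, i ∈ s ↔ i < 0 ∧ a i ≠ 0 := fun i => by simp [hs]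
  have hBs : ∀ x ∈ centeredAnnulus r R, B x = ∑ i ∈ s, a i * x ^ i := by
    intro x hx
    refine (hB x hx).unique ?_
    have h1 : ∑ i ∈ s, a i * x ^ i = ∑ i ∈ s, laurentNegPart a i * x ^ i :=
      Finset.sum_congr rfl fun i hi => by simp [laurentNegPart, ((hmem i).mp hi).1]
    rw [h1]
    refine hasSum_sum_of_ne_finset_zero fun i hi => ?_
    rw [hmem, not_and, not_not] at hi
    by_cases h : i < 0
    · simp [laurentNegPart, hi h]
    · simp [laurentNegPart, h]
  rcases s.eq_empty_or_nonempty with he | hne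
  · refine not_isSingularityOfSqrt hVo hV hA (z₀ := (((r + R) / 2 : ℝ) : ℂ)) hz.2 ?_
      (right_ne_zero_of_mul hpq) (hx.trans_lt hrR) hsing
    filter_upwards [(isOpen_centeredAnnulus r R).mem_nhds hz] with z hz
    have h1 := hBs z hz
    rw [he, Finset.sum_empty] at h1
    rw [← hf z hz, hfAB z hz, h1, add_zero]
  · set i₀ := s.min' hne with hi₀
    have hi₀s : i₀ ∈ s := s.min'_mem hne
    obtain ⟨m, hm⟩ : ∃ m : ℕ, (m : ℤ) = -i₀ :=
      ⟨(-i₀).toNat, Int.toNat_of_nonneg (by have := ((hmem _).mp hi₀s).1; omega)⟩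
    have hm0 : 0 < m := by have := ((hmem _).mp hi₀s).1; omega
    -- This is `x^m f`, where `m = -i₀` is the order of the pole at `0`. Every exponent `m + i` is
    -- nonnegative, and the value at `0` is `a i₀ ≠ 0`.
    have hF : AnalyticOnNhd ℂ (fun x => x ^ m * A x + ∑ i ∈ s, a i * x ^ ((m : ℤ) + i).toNat)
        {x | ‖x‖ < R} := fun x hx => by
      refine AnalyticAt.add ((analyticAt_id.pow m).mul (hA x hx)) ?_
      exact Finset.analyticAt_fun_sum _ fun i _ => analyticAt_const.mul (analyticAt_id.pow _)
    refine false_of_sq_mul_eq_pow_mul hV hF (z₀ := (((r + R) / 2 : ℝ) : ℂ)) hz.2 hm0 ?_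
      (by simpa using hr.trans_lt hrR) hVo ?_ hpq hroots
    · filter_upwards [(isOpen_centeredAnnulus r R).mem_nhds hz] with z hz
      have hz0 : z ≠ 0 := norm_pos_iff.mp (hr.trans_lt hz.1)
      have h1 : ∑ i ∈ s, a i * z ^ ((m : ℤ) + i).toNat = z ^ m * B z := by
        rw [hBs z hz, Finset.mul_sum]
        refine Finset.sum_congr rfl fun i hi => ?_
        have h2 : i₀ ≤ i := s.min'_le i hi
        rw [← zpow_natCast, Int.toNat_of_nonneg (by omega), zpow_add₀ hz0, zpow_natCast]
        ring
      rw [h1, ← mul_add, ← hfAB z hz, mul_pow, mul_assoc, hf z hz]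
    · have h1 : ∑ i ∈ s, a i * (0 : ℂ) ^ ((m : ℤ) + i).toNat = a i₀ := by
        rw [Finset.sum_eq_single i₀]
        · rw [hm]; simp
        · intro i hi hii
          have h2 : i₀ ≤ i := s.min'_le i hi
          rw [zero_pow (by omega), mul_zero]
        · exact fun h => absurd hi₀s h
      simp only [h1, zero_pow hm0.ne', zero_mul, zero_add]
      exact ((hmem _).mp hi₀s).2

end Singularities

/-! ### Assembly: from local Cauchy transforms to the theorem. -/

section MainTheorem

variable {P Q : ℂ[X][X]} {f : ℂ × ℂ → ℂ} {W : Set (ℂ × ℂ)}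

/-- A function that is locally a fixed multiple of Cauchy transforms of a branch of `√(P / Q)` is
D-finite. -/
theorem IsSqrtBranch.isDFiniteOn (hf : IsSqrtBranch P Q f W) {G : ℂ × ℂ → ℂ} {Z : Set (ℂ × ℂ)}
    (σ : ℂ) (hG : ∀ p ∈ Z, ∃ ρ : ℝ, 0 < ρ ∧ ‖p.1‖ ≠ ρ ∧
      (∀ y ∈ sphere (0 : ℂ) ρ, (y, p.2) ∈ W) ∧
      G =ᶠ[𝓝 p] fun p => σ * cauchyTransform f ρ p) : IsDFiniteOn G Z := by
  refine ⟨fun p hp => ?_, ?_, ?_⟩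
  · obtain ⟨ρ, hρ, hx, hW, hev⟩ := hG p hp
    exact (analyticAt_const.mul
      (analyticAt_cauchyTransform hf.isOpen hf.analytic hρ hx hW)).congr hev.symm
  -- The equation is fixed before the point and its radius, so different radii at different points
  -- still give a single equation on `Z`.
  · obtain ⟨n, c, hc, h⟩ := hf.exists_equation_fst
    refine ⟨n, c, hc, fun x t hp => ?_⟩
    obtain ⟨ρ, hρ, hx, hW, hev⟩ := hG _ hp
    have hev' : (fun y => G (y, t)) =ᶠ[𝓝 x] fun y => σ * cauchyTransform f ρ (y, t) :=
      (Continuous.tendsto (by fun_prop : Continuous fun y : ℂ => (y, t)) x).eventually hev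
    simp only [hev'.iteratedDeriv_eq, iteratedDeriv_const_mul_field]
    have h2 := congrArg (σ * ·) (h x t ρ hρ hx hW)
    simp only [Finset.mul_sum, mul_zero] at h2
    refine Eq.trans (Finset.sum_congr rfl fun j _ => ?_) h2
    ring
  · obtain ⟨n, c, hc, h⟩ := hf.exists_equation_snd
    refine ⟨n, c, hc, fun x t hp => ?_⟩
    obtain ⟨ρ, hρ, hx, hW, hev⟩ := hG _ hp
    have hev' : (fun s => G (x, s)) =ᶠ[𝓝 t] fun s => σ * cauchyTransform f ρ (x, s) :=
      (Continuous.tendsto (by fun_prop : Continuous fun s : ℂ => (x, s)) t).eventually hev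
    simp only [hev'.iteratedDeriv_eq, iteratedDeriv_const_mul_field]
    have h2 := congrArg (σ * ·) (h x t ρ hρ hx hW)
    simp only [Finset.mul_sum, mul_zero] at h2
    refine Eq.trans (Finset.sum_congr rfl fun j _ => ?_) h2
    ring

theorem isOpen_annulusFamily {U : Set ℂ} (hU : IsOpen U) {r R : ℂ → ℝ} (hr : ContinuousOn r U)
    (hR : ContinuousOn R U) : IsOpen (annulusFamily U r R) := by
  rw [isOpen_iff_mem_nhds]
  rintro ⟨x, t⟩ ⟨ht, h1, h2⟩
  have hfst : ContinuousAt (fun p : ℂ × ℂ => ‖p.1‖) (x, t) := by fun_prop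
  have hr' : ContinuousAt (fun p : ℂ × ℂ => r p.2) (x, t) :=
    (hr.continuousAt (hU.mem_nhds ht)).comp (f := fun p : ℂ × ℂ => p.2) continuousAt_snd
  have hR' : ContinuousAt (fun p : ℂ × ℂ => R p.2) (x, t) :=
    (hR.continuousAt (hU.mem_nhds ht)).comp (f := fun p : ℂ × ℂ => p.2) continuousAt_snd
  filter_upwards [continuousAt_snd.preimage_mem_nhds (hU.mem_nhds ht),
    hr'.eventually_lt hfst h1, hfst.eventually_lt hR' h2] with p hp1 hp2 hp3
  exact ⟨hp1, hp2, hp3⟩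

end MainTheorem

theorem mainTheorem5 (P Q : Polynomial (Polynomial ℂ)) (U : Set ℂ) (hU : IsOpen U)
    (r R : ℂ → ℝ) (hr : ContinuousOn r U) (hR : ContinuousOn R U)
    (hrR : ∀ t ∈ U, 0 ≤ r t ∧ r t < R t)
    (hdist : ∀ t ∈ U, HasDistinctZerosAndPoles P Q t)
    (f : ℂ × ℂ → ℂ) (hf : AnalyticOnNhd ℂ f (annulusFamily U r R))
    (hsqrt : ∀ x t : ℂ, (x, t) ∈ annulusFamily U r R → f (x, t) ^ 2 = ratEval P Q x t)
    (hin : ∀ t ∈ U, ∃ x₀ : ℂ, ‖x₀‖ ≤ r t ∧ IsSingularityOfSqrt (fun x => ratEval P Q x t) x₀)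
    (hout : ∀ t ∈ U, ∃ x₀ : ℂ, R t ≤ ‖x₀‖ ∧ IsSingularityOfSqrt (fun x => ratEval P Q x t) x₀) :
    ∃ (a : ℂ → ℤ → ℂ) (A B : ℂ × ℂ → ℂ),
      (∀ x t : ℂ, (x, t) ∈ annulusFamily U r R → HasLaurentSum (a t) x (f (x, t))) ∧
      (∀ t ∈ U, {i : ℤ | 0 < i ∧ a t i ≠ 0}.Infinite ∧ {i : ℤ | i < 0 ∧ a t i ≠ 0}.Infinite) ∧
      (∀ x t : ℂ, (x, t) ∈ discFamily U R → HasLaurentSum (laurentNonnegPart (a t)) x (A (x, t))) ∧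
      (∀ x t : ℂ, (x, t) ∈ exteriorFamily U r → HasLaurentSum (laurentNegPart (a t)) x (B (x, t))) ∧
      (∀ x t : ℂ, (x, t) ∈ annulusFamily U r R → f (x, t) = A (x, t) + B (x, t)) ∧
      IsDFiniteOn A (discFamily U R) ∧
      IsDFiniteOn B (exteriorFamily U r) := by
  have hbr : IsSqrtBranch P Q f (annulusFamily U r R) :=
    ⟨isOpen_annulusFamily hU hr hR, hf, fun p hp => hdist _ hp.1, fun p hp => hsqrt _ _ hp⟩
  have hslice : ∀ t ∈ U, DifferentiableOn ℂ (fun y => f (y, t)) (centeredAnnulus (r t) (R t)) :=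
    fun t ht => (hbr.differentiableOn_fst t).mono fun y hy => ⟨ht, hy.1, hy.2⟩
  have hci : ∀ t ∈ U, ∀ ρ, r t < ρ → ρ < R t → CircleIntegrable (fun y => f (y, t)) 0 ρ :=
    fun t ht ρ h1 h2 => ((hslice t ht).continuousOn.mono
      (sphere_subset_centeredAnnulus h1 h2)).circleIntegrable ((hrR t ht).1.trans h1.le)
  -- The middle radius is an arbitrary choice; the next fact shows independence of the radius.
  let a : ℂ → ℤ → ℂ := fun t => laurentCoeff (fun y => f (y, t)) ((r t + R t) / 2)
  have ha : ∀ t ∈ U, ∀ ρ, r t < ρ → ρ < R t → laurentCoeff (fun y => f (y, t)) ρ = a t :=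
    fun t ht ρ h1 h2 => funext fun i => laurentCoeff_eq (hrR t ht).1 (hslice t ht) ⟨h1, h2⟩
      ⟨by linarith [hrR t ht], by linarith [hrR t ht]⟩ i
  have hA : ∀ t ∈ U, ∀ x ρ, r t < ρ → ρ < R t → ‖x‖ < ρ →
      HasLaurentSum (laurentNonnegPart (a t)) x (cauchyTransform f ρ (x, t)) :=
    fun t ht x ρ h1 h2 hx => by
      rw [← ha t ht ρ h1 h2]
      exact hasSum_laurentNonnegPart (hasSum_laurentCoeff_nonneg (hci t ht ρ h1 h2) hx)
  have hB : ∀ t ∈ U, ∀ x ρ, r t < ρ → ρ < R t → ρ < ‖x‖ →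
      HasLaurentSum (laurentNegPart (a t)) x (-cauchyTransform f ρ (x, t)) :=
    fun t ht x ρ h1 h2 hx => by
      rw [← ha t ht ρ h1 h2]
      exact hasSum_laurentNegPart (hasSum_laurentCoeff_neg ((hrR t ht).1.trans_lt h1)
        (hci t ht ρ h1 h2) hx)
  let A : ℂ × ℂ → ℂ := fun p => ∑' i : ℤ, laurentNonnegPart (a p.2) i * p.1 ^ i
  let B : ℂ × ℂ → ℂ := fun p => ∑' i : ℤ, laurentNegPart (a p.2) i * p.1 ^ i
  have hAeq : ∀ t ∈ U, ∀ x ρ, r t < ρ → ρ < R t → ‖x‖ < ρ →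
      A (x, t) = cauchyTransform f ρ (x, t) := fun t ht x ρ h1 h2 h3 =>
    (hA t ht x ρ h1 h2 h3).tsum_eq
  have hBeq : ∀ t ∈ U, ∀ x ρ, r t < ρ → ρ < R t → ρ < ‖x‖ →
      B (x, t) = -cauchyTransform f ρ (x, t) := fun t ht x ρ h1 h2 h3 =>
    (hB t ht x ρ h1 h2 h3).tsum_eq
  have hAsum : ∀ x t : ℂ, (x, t) ∈ discFamily U R →
      HasLaurentSum (laurentNonnegPart (a t)) x (A (x, t)) := fun x t hp => by
    -- The circle must lie in the annulus and enclose `x`, which may itself lie anywhere in the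
    -- disc.
    obtain ⟨ρ, h1, h2⟩ := exists_between (max_lt (hrR t hp.1).2 hp.2)
    have h3 := max_lt_iff.mp h1
    rw [hAeq t hp.1 x ρ h3.1 h2 h3.2]
    exact hA t hp.1 x ρ h3.1 h2 h3.2
  have hBsum : ∀ x t : ℂ, (x, t) ∈ exteriorFamily U r →
      HasLaurentSum (laurentNegPart (a t)) x (B (x, t)) := fun x t hp => by
    obtain ⟨ρ, h1, h2⟩ := exists_between (lt_min (hrR t hp.1).2 hp.2)
    have h3 := lt_min_iff.mp h2
    rw [hBeq t hp.1 x ρ h1 h3.1 h3.2]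
    exact hB t hp.1 x ρ h1 h3.1 h3.2
  have hfAB : ∀ x t : ℂ, (x, t) ∈ annulusFamily U r R → f (x, t) = A (x, t) + B (x, t) := by
    rintro x t ⟨ht, h1, h2⟩
    obtain ⟨ρ₁, h3, h4⟩ := exists_between h1
    obtain ⟨ρ₂, h5, h6⟩ := exists_between h2
    simp only at h1 h2 h3 h4 h5 h6 ht
    rw [hAeq t ht x ρ₂ (h1.trans h5) h6 h5, hBeq t ht x ρ₁ h3 (h4.trans h2) h4]
    exact circleIntegral_sub_circleIntegral_eq (hrR t ht).1 (hslice t ht) h3 h4 h5 h6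
  have hsph : ∀ t ∈ U, ∀ ρ, r t < ρ → ρ < R t → ∀ y ∈ sphere (0 : ℂ) ρ,
      (y, t) ∈ annulusFamily U r R := fun t ht ρ h1 h2 y hy =>
    ⟨ht, sphere_subset_centeredAnnulus h1 h2 hy⟩
  -- By continuity of `r` and `R` a fixed radius stays admissible for nearby `t`, so `A` and `B`
  -- agree near each point with a transform over one fixed circle.
  have hnear : ∀ (x t : ℂ) (ρ : ℝ), t ∈ U → r t < ρ → ρ < R t → ∀ᶠ p : ℂ × ℂ in 𝓝 (x, t),
      p.2 ∈ U ∧ r p.2 < ρ ∧ ρ < R p.2 := fun x t ρ ht h1 h2 => by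
    have h3 := (continuousAt_snd (p := (x, t))).eventually (hU.mem_nhds ht)
    have h4 := (continuousAt_snd (p := (x, t))).eventually
      ((hr.continuousAt (hU.mem_nhds ht)).eventually_lt continuousAt_const h1)
    have h5 := (continuousAt_snd (p := (x, t))).eventually
      (continuousAt_const.eventually_lt (hR.continuousAt (hU.mem_nhds ht)) h2)
    filter_upwards [h3, h4, h5] with p p1 p2 p3 using ⟨p1, p2, p3⟩
  have hAD : IsDFiniteOn A (discFamily U R) := by
    refine hbr.isDFiniteOn 1 ?_
    rintro ⟨x, t⟩ ⟨ht, hx⟩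
    obtain ⟨ρ, h1, h2⟩ := exists_between (max_lt (hrR t ht).2 hx)
    have h3 := max_lt_iff.mp h1
    refine ⟨ρ, (hrR t ht).1.trans_lt h3.1, h3.2.ne, hsph t ht ρ h3.1 h2, ?_⟩
    have h4 : ∀ᶠ p : ℂ × ℂ in 𝓝 (x, t), ‖p.1‖ < ρ :=
      (by fun_prop : Continuous fun p : ℂ × ℂ => ‖p.1‖).continuousAt.eventually_lt
        continuousAt_const h3.2
    filter_upwards [hnear x t ρ ht h3.1 h2, h4] with p hp hpx
    rw [one_mul]
    exact hAeq p.2 hp.1 p.1 ρ hp.2.1 hp.2.2 hpx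
  have hBD : IsDFiniteOn B (exteriorFamily U r) := by
    refine hbr.isDFiniteOn (-1) ?_
    rintro ⟨x, t⟩ ⟨ht, hx⟩
    obtain ⟨ρ, h1, h2⟩ := exists_between (lt_min (hrR t ht).2 hx)
    have h3 := lt_min_iff.mp h2
    refine ⟨ρ, (hrR t ht).1.trans_lt h1, h3.2.ne', hsph t ht ρ h1 h3.1, ?_⟩
    have h4 : ∀ᶠ p : ℂ × ℂ in 𝓝 (x, t), ρ < ‖p.1‖ :=
      continuousAt_const.eventually_lt
        (by fun_prop : Continuous fun p : ℂ × ℂ => ‖p.1‖).continuousAt h3.2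
    filter_upwards [hnear x t ρ ht h1 h3.1, h4] with p hp hpx
    rw [neg_one_mul]
    exact hBeq p.2 hp.1 p.1 ρ hp.2.1 hp.2.2 hpx
  refine ⟨a, A, B, fun x t hp => ?_, fun t ht => ⟨?_, ?_⟩, hAsum, hBsum, hfAB, hAD, hBD⟩
  · rw [hfAB x t hp]
    exact (hAsum x t ⟨hp.1, hp.2.2⟩).of_parts (hBsum x t ⟨hp.1, hp.2.1⟩)
  · obtain ⟨x₀, hx₀, hs⟩ := hout t ht
    exact infinite_pos_of_isSingularityOfSqrt (f := fun x => f (x, t)) (A := fun x => A (x, t))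
      (B := fun x => B (x, t)) (hrR t ht).1 (hrR t ht).2
      (fun x hx => (hBD.1 (x, t) ⟨ht, hx⟩).comp (f := fun x : ℂ => (x, t))
        (analyticAt_id.prod analyticAt_const))
      (fun x hx => hAsum x t ⟨ht, hx.2⟩) (fun x hx => hfAB x t ⟨ht, hx⟩)
      (fun x hx => hbr.sq_mul_eq ⟨ht, hx⟩) (right_ne_zero_of_mul (hdist t ht).1) hx₀ hs
  · obtain ⟨x₀, hx₀, hs⟩ := hin t ht
    exact infinite_neg_of_isSingularityOfSqrt (f := fun x => f (x, t)) (A := fun x => A (x, t))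
      (B := fun x => B (x, t)) (hrR t ht).1 (hrR t ht).2
      (fun x hx => (hAD.1 (x, t) ⟨ht, hx⟩).comp (f := fun x : ℂ => (x, t))
        (analyticAt_id.prod analyticAt_const))
      (fun x hx => hBsum x t ⟨ht, hx.1⟩) (fun x hx => hfAB x t ⟨ht, hx⟩)
      (fun x hx => hbr.sq_mul_eq ⟨ht, hx⟩) (hdist t ht).1 (hdist t ht).2 hx₀ hs
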